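/- **Conventions.** A modulus of continuity is a continuous increasing function $\rho:[0,1]\to[0,\infty)$ with $\rho(0)=0$ and $\rho(h)>0$ for $h>0$. For $f:[0,1]\to\mathbb{R}$ put $|f|_\rho=\sup_{u,v\in[0,1]}|f(u)-f(v)|/\rho(|u-v|)$, where $0/0=0$ and $x/0=\infty$ for $x>0$ (the same convention is used for quotients by $\rho_0$ below). $C^\rho$ is the space of continuous $f:[0,1]\to\mathbb{R}$ with $|f|_\rho<\infty$, normed by $\|f\|_\rho=\|f\|_\infty+|f|_\rho$, and $C^\rho_0$ is the subspace of those $f\in C^\rho$ with $\lim_{\delta\downarrow0}\sup_{0<|u-v|<\delta}|f(u)-f(v)|/\rho(|u-v|)=0$. We write $\rho\gg\rho_0$ if $\rho_0(h)/\rho(h)\to0$ as $h\downarrow0$ (that is, $\rho(h)/\rho_0(h)\to\infty$). For $\tau\in\mathbb{R}$ and real random variables, $X_n\Rightarrow_\tau X$ means that $P(X_n>t)\to P(X>t)$ for every $t>\tau$ that is a continuity point of the distribution function of $X$. $\Rightarrow_{\mathrm{fidi}}$ denotes weak convergence of all finite dimensional marginals. **Theorem.** Let $W_n$ be a sequence of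 stochastic processes with paths in $C[0,1]$ (possibly on different probability spaces), and let $\rho_0:[0,1]\to[0,\infty)$ be an increasing function with $\rho_0(0)=0$. Suppose there is $C>0$ such that for every $t>C$ there are $\kappa(t)>1$ and $K(t)>0$ with $$P\left(\frac{|W_n(u)-W_n(v)|}{\rho_0(|u-v|)}>t\right)\le K(t)\,|u-v|^{\kappa(t)},\qquad u,v\in[0,1],\ n\in\mathbb{N}, \tag{T}$$ and that there are $p>0$ and $\widetilde K>0$ with $$\rho_0(zh)\le\widetilde K z^p\rho_0(h),\qquad h,z\in[0,1]. \tag{R}$$ 1. For every $t>C$, $$\sup_n P\left(\sup_{u,v\in[0,1],\,|u-v|\le h}\frac{|W_n(u)-W_n(v)|}{\rho_0(|u-v|)}>t\right)\longrightarrow0\quad\text{as }h\downarrow0.$$ 2. For every modulus of continuity $\rho\gg\rho_0$ the sequence $|W_n|_\rho$ is stochastically bounded. 3. Suppose in addition that $W_n\Rightarrow_{\mathrm{fidi}}W$ for some real-valued stochastic process $W$ on $[0,1]$. Then $W$ has a modification with paths in $C[0,1]$, and for every such modification, again denoted by $W$ (in particular for $W$ itself if its paths are continuous), the following holds. - For every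 modulus of continuity $\rho\gg\rho_0$, almost surely $W_n\in C^\rho_0$ for all $n$ and $W\in C^\rho_0$, and $W_n\Rightarrow W$ weakly in $C^\rho_0$. - For every modulus of continuity $\rho$ with $\rho(h)/\rho_0(h)\to1$ as $h\downarrow0$, the seminorms $|W_n|_\rho$ and $|W|_\rho$ are almost surely finite and $|W_n|_\rho\Rightarrow_C|W|_\rho$. -/

import Mathlib

open Filter Topology MeasureTheory ProbabilityTheory
open scoped ENNReal unitInterval

noncomputable section

/-- A modulus of continuity on `[0,1]`: continuous, increasing (in the weak sense), zero at `0` and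
positive elsewhere. Only the values on `[0,1]` matter. -/
structure IsModulus (ρ : ℝ → ℝ) : Prop where
  continuousOn : ContinuousOn ρ (Set.Icc 0 1)
  monotoneOn : MonotoneOn ρ (Set.Icc 0 1)
  map_zero : ρ 0 = 0
  pos : ∀ h ∈ Set.Ioc (0 : ℝ) 1, 0 < ρ h

/-- `ρ ≫ ρ'`, i.e. `ρ'(h) / ρ(h) → 0` as `h ↓ 0`. -/
def MuchLarger (ρ ρ' : ℝ → ℝ) : Prop :=
  Tendsto (fun h => ρ' h / ρ h) (𝓝[>] 0) (𝓝 0)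

/-- The weighted increment `|f(u) - f(v)| / ρ(|u - v|)` in `[0,∞]`, where `0 / 0 = 0` and
`x / 0 = ∞` for `x > 0`. In particular the value is `0` when `u = v`. -/
def weightedIncr (ρ : ℝ → ℝ) (f : I → ℝ) (u v : I) : ℝ≥0∞ :=
  ‖f u - f v‖ₑ / ENNReal.ofReal (ρ |(u : ℝ) - v|)

/-- The local Hölder modulus: the supremum of `|f(u) - f(v)| / ρ(|u - v|)` over `|u - v| ≤ h`. -/
def localHolder (ρ : ℝ → ℝ) (h : ℝ) (f : I → ℝ) : ℝ≥0∞ :=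
  ⨆ (u : I) (v : I) (_ : |(u : ℝ) - v| ≤ h), weightedIncr ρ f u v

/-- The Hölder-type seminorm `|f|_ρ`, with values in `[0,∞]`. -/
def holderSeminorm (ρ : ℝ → ℝ) (f : I → ℝ) : ℝ≥0∞ :=
  ⨆ (u : I) (v : I), weightedIncr ρ f u v

theorem weightedIncr_zero (ρ : ℝ → ℝ) (u v : I) : weightedIncr ρ (fun _ => 0) u v = 0 := by
  simp [weightedIncr]

theorem weightedIncr_add (ρ : ℝ → ℝ) (f g : I → ℝ) (u v : I) :
    weightedIncr ρ (fun x => f x + g x) u v ≤ weightedIncr ρ f u v + weightedIncr ρ g u v := by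
  unfold weightedIncr
  rw [← ENNReal.add_div]
  gcongr
  rw [show f u + g u - (f v + g v) = (f u - f v) + (g u - g v) by ring]
  exact enorm_add_le _ _

theorem weightedIncr_smul (ρ : ℝ → ℝ) (c : ℝ) (f : I → ℝ) (u v : I) :
    weightedIncr ρ (fun x => c * f x) u v = ‖c‖ₑ * weightedIncr ρ f u v := by
  unfold weightedIncr
  rw [← mul_sub, enorm_mul, mul_div_assoc]

theorem localHolder_zero (ρ : ℝ → ℝ) (h : ℝ) : localHolder ρ h (fun _ => 0) = 0 := by
  simp [localHolder, weightedIncr_zero]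

theorem localHolder_add (ρ : ℝ → ℝ) (h : ℝ) (f g : I → ℝ) :
    localHolder ρ h (fun x => f x + g x) ≤ localHolder ρ h f + localHolder ρ h g := by
  refine iSup_le fun u => iSup_le fun v => iSup_le fun huv => ?_
  refine (weightedIncr_add ρ f g u v).trans (add_le_add ?_ ?_)
  · exact le_iSup_of_le u (le_iSup_of_le v (le_iSup_of_le huv le_rfl))
  · exact le_iSup_of_le u (le_iSup_of_le v (le_iSup_of_le huv le_rfl))

theorem localHolder_smul (ρ : ℝ → ℝ) (h : ℝ) (c : ℝ) (f : I → ℝ) :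
    localHolder ρ h (fun x => c * f x) = ‖c‖ₑ * localHolder ρ h f := by
  simp only [localHolder, weightedIncr_smul, ENNReal.mul_iSup]

theorem holderSeminorm_zero (ρ : ℝ → ℝ) : holderSeminorm ρ (fun _ => 0) = 0 := by
  simp [holderSeminorm, weightedIncr_zero]

theorem holderSeminorm_add (ρ : ℝ → ℝ) (f g : I → ℝ) :
    holderSeminorm ρ (fun x => f x + g x) ≤ holderSeminorm ρ f + holderSeminorm ρ g := by
  refine iSup_le fun u => iSup_le fun v => ?_
  refine (weightedIncr_add ρ f g u v).trans (add_le_add ?_ ?_)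
  · exact le_iSup_of_le u (le_iSup_of_le v le_rfl)
  · exact le_iSup_of_le u (le_iSup_of_le v le_rfl)

theorem holderSeminorm_smul (ρ : ℝ → ℝ) (c : ℝ) (f : I → ℝ) :
    holderSeminorm ρ (fun x => c * f x) = ‖c‖ₑ * holderSeminorm ρ f := by
  simp only [holderSeminorm, weightedIncr_smul, ENNReal.mul_iSup]

/-- The continuous functions on `[0,1]` with finite Hölder-type seminorm. -/
def holderSubmodule (ρ : ℝ → ℝ) : Submodule ℝ C(I, ℝ) where
  carrier := {f | holderSeminorm ρ f ≠ ∞}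
  zero_mem' := by
    have h : holderSeminorm ρ (fun _ => 0) ≠ ∞ := by simp [holderSeminorm_zero]
    exact h
  add_mem' := by
    intro f g hf hg
    exact ne_top_of_le_ne_top (ENNReal.add_ne_top.2 ⟨hf, hg⟩) (holderSeminorm_add ρ f g)
  smul_mem' := by
    intro c f hf
    have h : holderSeminorm ρ (fun x => c * f x) ≠ ∞ := by
      rw [holderSeminorm_smul]
      exact ENNReal.mul_ne_top enorm_ne_top hf
    exact h

/-- The space `C^ρ`. It is a type of its own, so that it carries the norm below and not the
supremum norm inherited from `C[0,1]`. -/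
def HolderSpace (ρ : ℝ → ℝ) : Type := holderSubmodule ρ

instance (ρ : ℝ → ℝ) : AddCommGroup (HolderSpace ρ) :=
  inferInstanceAs (AddCommGroup (holderSubmodule ρ))

instance (ρ : ℝ → ℝ) : Module ℝ (HolderSpace ρ) :=
  inferInstanceAs (Module ℝ (holderSubmodule ρ))

/-- The underlying continuous function of an element of `C^ρ`. -/
def HolderSpace.toC {ρ : ℝ → ℝ} (f : HolderSpace ρ) : C(I, ℝ) := Subtype.val f

/-- The norm `‖f‖_ρ = ‖f‖_∞ + |f|_ρ` on `C^ρ`. -/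
def holderNorm (ρ : ℝ → ℝ) : AddGroupNorm (HolderSpace ρ) where
  toFun f := ‖f.toC‖ + (holderSeminorm ρ f.toC).toReal
  map_zero' := by
    have h1 : (0 : HolderSpace ρ).toC = 0 := rfl
    have h2 : holderSeminorm ρ ((0 : C(I, ℝ)) : I → ℝ) = 0 := holderSeminorm_zero ρ
    rw [h1, h2]
    simp
  add_le' := by
    intro f g
    have h1 : (f + g).toC = f.toC + g.toC := rfl
    have h2 := ENNReal.toReal_mono (ENNReal.add_ne_top.2 ⟨f.2, g.2⟩)
      (holderSeminorm_add ρ f.toC g.toC)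
    rw [ENNReal.toReal_add f.2 g.2] at h2
    have h3 := norm_add_le f.toC g.toC
    rw [h1]
    have h4 : (holderSeminorm ρ (f.toC + g.toC : C(I, ℝ))).toReal
        ≤ (holderSeminorm ρ f.toC).toReal + (holderSeminorm ρ g.toC).toReal := h2
    linarith
  neg' := by
    intro f
    have h1 : (-f).toC = -f.toC := rfl
    have h2 : holderSeminorm ρ (-f.toC : C(I, ℝ)) = holderSeminorm ρ f.toC := by
      have h := holderSeminorm_smul ρ (-1) f.toC
      simp only [neg_mul, one_mul, enorm_neg, enorm_one] at h
      exact h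
    rw [h1, h2, norm_neg]
  eq_zero_of_map_eq_zero' := by
    intro f hf
    have h1 : ‖f.toC‖ = 0 := by
      have h2 := norm_nonneg f.toC
      have h3 := ENNReal.toReal_nonneg (a := holderSeminorm ρ f.toC)
      linarith
    exact Subtype.ext (norm_eq_zero.1 h1)

instance (ρ : ℝ → ℝ) : NormedAddCommGroup (HolderSpace ρ) :=
  (holderNorm ρ).toNormedAddCommGroup

instance (ρ : ℝ → ℝ) : MeasurableSpace (HolderSpace ρ) := borel _

instance (ρ : ℝ → ℝ) : BorelSpace (HolderSpace ρ) := ⟨rfl⟩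

/-- The subspace `C^ρ_0` of `C^ρ`, with the norm of `C^ρ`: functions whose local Hölder modulus
vanishes as `δ ↓ 0`. (The supremum over `0 < |u - v| < δ` and the one over `|u - v| ≤ δ` have the
same limit.) -/
def holderZero (ρ : ℝ → ℝ) : Submodule ℝ (HolderSpace ρ) where
  carrier := {f | Tendsto (fun δ => localHolder ρ δ f.toC) (𝓝[>] 0) (𝓝 0)}
  zero_mem' := by
    have h : Tendsto (fun δ => localHolder ρ δ (fun _ => 0)) (𝓝[>] 0) (𝓝 0) := by
      simp [localHolder_zero]
    exact h
  add_mem' := by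
    intro f g hf hg
    have h := Tendsto.add hf hg
    rw [add_zero] at h
    exact tendsto_of_tendsto_of_tendsto_of_le_of_le tendsto_const_nhds h
      (fun _ => bot_le) (fun δ => localHolder_add ρ δ f.toC g.toC)
  smul_mem' := by
    intro c f hf
    have h := ENNReal.Tendsto.const_mul (a := ‖c‖ₑ) hf (Or.inr enorm_ne_top)
    rw [mul_zero] at h
    have h' : Tendsto (fun δ => localHolder ρ δ (fun x => c * f.toC x)) (𝓝[>] 0) (𝓝 0) := by
      simpa only [localHolder_smul] using h
    exact h'

/-- A stochastic process on `[0,1]` all of whose paths are continuous. -/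
structure IsContinuousProcess {Ω : Type*} [MeasurableSpace Ω] (W : I → Ω → ℝ) : Prop where
  measurable : ∀ u, Measurable (W u)
  continuous : ∀ ω, Continuous fun u => W u ω

/-- Weak convergence `W_n ⇒_fidi W` of all finite dimensional marginals. -/
def TendstoFidi {Ω : ℕ → Type*} [∀ n, MeasurableSpace (Ω n)] (P : ∀ n, Measure (Ω n))
    [∀ n, IsProbabilityMeasure (P n)] {Ω' : Type*} [MeasurableSpace Ω'] (P' : Measure Ω')
    [IsProbabilityMeasure P'] (W : ∀ n, I → Ω n → ℝ) (W' : I → Ω' → ℝ) : Prop :=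
  ∀ s : Finset I, TendstoInDistribution (fun n ω (u : s) => W n u ω) atTop
    (fun ω (u : s) => W' u ω) P P'

/-- Weak convergence `W_n ⇒ W` in `C^ρ_0`: almost surely the paths of the processes lie in
`C^ρ_0`, they define random elements of this normed space, and these converge in distribution. -/
def TendstoHolderZero (ρ : ℝ → ℝ) {Ω : ℕ → Type*} [∀ n, MeasurableSpace (Ω n)]
    (P : ∀ n, Measure (Ω n)) [∀ n, IsProbabilityMeasure (P n)] {Ω' : Type*} [MeasurableSpace Ω']
    (P' : Measure Ω') [IsProbabilityMeasure P'] (W : ∀ n, I → Ω n → ℝ) (W' : I → Ω' → ℝ) : Prop :=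
  ∃ (X : ∀ n, Ω n → holderZero ρ) (X' : Ω' → holderZero ρ),
    (∀ n, ∀ᵐ ω ∂(P n), ∀ u, (X n ω).1.toC u = W n u ω) ∧
    (∀ᵐ ω ∂P', ∀ u, (X' ω).1.toC u = W' u ω) ∧
    TendstoInDistribution X atTop X' P P'

/-- Weak convergence `X_n ⇒_τ X` beyond the threshold `τ`: `P(X_n > t) → P(X > t)` at every `t > τ`
at which the distribution function of `X` is continuous. -/
def TendstoBeyond (τ : ℝ) {Ω : ℕ → Type*} [∀ n, MeasurableSpace (Ω n)] (P : ∀ n, Measure (Ω n))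
    {Ω' : Type*} [MeasurableSpace Ω'] (P' : Measure Ω') (X : ∀ n, Ω n → ℝ) (X' : Ω' → ℝ) : Prop :=
  ∀ t, τ < t → ContinuousAt (fun s => P' {ω | X' ω ≤ s}) t →
    Tendsto (fun n => P n {ω | t < X n ω}) atTop (𝓝 (P' {ω | t < X' ω}))

end

/-!
If neighbouring points of the dyadic grids alone are controlled, chaining yields (T) only up to a
constant factor. One therefore controls all increments over at most `2 ^ N` grid steps at once, by
a union bound that is summable over the levels because `κ > 1`. Two points `u < v` at distance about
`2 ^ (-n)` are then joined by a single long increment of level `n + N` and by two chains that start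
only at that level, whose contribution is by (R) at most a constant times `2 ^ (-p N) ρ₀(v - u)`.
For large `N` the loss is a factor arbitrarily close to `1`, so that every `t > C` is reached.

The map `f ↦ ((u, v) ↦ f 0 + (f u - f v) / ρ(|u - v|))` embeds `C^ρ_0` into `C([0,1]²)`, where
convergence of the marginals and stochastic equicontinuity give weak convergence. If `ρ / ρ₀ → 1`,
then `|f|_ρ > t` is an open condition on `f` in `C[0,1]`, and for `t > C` only increments over
distances bounded away from `0` matter in the limit, for which `≥ t` is a closed condition.
-/

section Gauge

variable {ρ ρ₀ : ℝ → ℝ} {p K s t x : ℝ}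

/-- An increasing function on `[0,1]` that vanishes at `0` and decays at least like a power under
scaling; this is the hypothesis (R) on `ρ₀`, with its constants as parameters. -/
structure IsPowerGauge (ρ : ℝ → ℝ) (p K : ℝ) : Prop where
  monotoneOn : MonotoneOn ρ (Set.Icc 0 1)
  map_zero : ρ 0 = 0
  p_pos : 0 < p
  K_pos : 0 < K
  scale : ∀ h ∈ Set.Icc (0 : ℝ) 1, ∀ z ∈ Set.Icc (0 : ℝ) 1, ρ (z * h) ≤ K * z ^ p * ρ h

theorem dist_mem_Icc (u v : I) : dist u v ∈ Set.Icc (0 : ℝ) 1 :=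
  ⟨dist_nonneg, abs_sub_le_iff.2 ⟨by linarith [u.2.2, v.2.1], by linarith [u.2.1, v.2.2]⟩⟩

theorem half_pow_mem_Icc (m : ℕ) : ((1 : ℝ) / 2) ^ m ∈ Set.Icc (0 : ℝ) 1 :=
  ⟨by positivity, pow_le_one₀ (by norm_num) (by norm_num)⟩

theorem half_rpow_pos (p : ℝ) : 0 < ((1 : ℝ) / 2) ^ p :=
  Real.rpow_pos_of_pos (by norm_num) p

theorem half_rpow_lt_one (hp : 0 < p) : ((1 : ℝ) / 2) ^ p < 1 :=
  Real.rpow_lt_one (by norm_num) (by norm_num) hp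

theorem half_pow_rpow (m : ℕ) (p : ℝ) : (((1 : ℝ) / 2) ^ m) ^ p = ((1 / 2) ^ p) ^ m := by
  rw [← Real.rpow_natCast, ← Real.rpow_natCast, ← Real.rpow_mul (by norm_num),
    ← Real.rpow_mul (by norm_num), mul_comm]

theorem nonneg_of_monotoneOn_Icc (hmono : MonotoneOn ρ (Set.Icc 0 1)) (h0 : ρ 0 = 0)
    (hx : x ∈ Set.Icc (0 : ℝ) 1) : 0 ≤ ρ x :=
  h0 ▸ hmono (Set.left_mem_Icc.2 zero_le_one) hx hx.1

theorem IsModulus.nonneg (hρ : IsModulus ρ) (hx : x ∈ Set.Icc (0 : ℝ) 1) : 0 ≤ ρ x :=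
  nonneg_of_monotoneOn_Icc hρ.monotoneOn hρ.map_zero hx

theorem IsPowerGauge.nonneg (hρ : IsPowerGauge ρ p K) (hx : x ∈ Set.Icc (0 : ℝ) 1) : 0 ≤ ρ x :=
  nonneg_of_monotoneOn_Icc hρ.monotoneOn hρ.map_zero hx

theorem IsPowerGauge.le_rpow (hρ : IsPowerGauge ρ p K) (hx : x ∈ Set.Icc (0 : ℝ) 1) :
    ρ x ≤ K * x ^ p * ρ 1 := by
  simpa only [mul_one] using hρ.scale 1 (by simp) x hx

theorem IsPowerGauge.half_pow_add_le (hρ : IsPowerGauge ρ p K) (n i : ℕ) :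
    ρ ((1 / 2) ^ (n + i)) ≤ K * ((1 / 2 : ℝ) ^ p) ^ i * ρ ((1 / 2) ^ n) := by
  have h := hρ.scale _ (half_pow_mem_Icc n) _ (half_pow_mem_Icc i)
  rwa [← pow_add, add_comm i n, half_pow_rpow] at h

theorem IsPowerGauge.tendsto_zero (hρ : IsPowerGauge ρ p K) {ι : Type*} {l : Filter ι} {g : ι → ℝ}
    (hg : Tendsto g l (𝓝 0)) (hmem : ∀ i, g i ∈ Set.Icc (0 : ℝ) 1) :
    Tendsto (fun i => ρ (g i)) l (𝓝 0) := by
  have hbound : Tendsto (fun i => K * g i ^ p * ρ 1) l (𝓝 0) := by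
    simpa [Real.zero_rpow hρ.p_pos.ne'] using
      ((hg.rpow_const (Or.inr hρ.p_pos.le)).const_mul K).mul_const (ρ 1)
  exact squeeze_zero (fun i => hρ.nonneg (hmem i)) (fun i => hρ.le_rpow (hmem i)) hbound

theorem IsModulus.continuous_dist (hρ : IsModulus ρ) {X : Type*} [TopologicalSpace X]
    {f g : X → I} (hf : Continuous f) (hg : Continuous g) :
    Continuous fun x => ρ (dist (f x) (g x)) :=
  hρ.continuousOn.comp_continuous (hf.dist hg) fun x => dist_mem_Icc (f x) (g x)

theorem MuchLarger.eventually_mul_le (hm : MuchLarger ρ ρ₀) (hρ : IsModulus ρ) (hs : 0 < s)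
    (ht : 0 < t) : ∀ᶠ x in 𝓝[>] 0, s * ρ₀ x ≤ t * ρ x := by
  filter_upwards [hm.eventually_le_const (div_pos ht hs), Ioc_mem_nhdsGT zero_lt_one] with x hx hx1
  rwa [div_le_div_iff₀ (hρ.pos x hx1) hs, mul_comm] at hx

theorem eventually_mul_le_of_tendsto_div_one (hρ₀ : IsPowerGauge ρ₀ p K)
    (h : Tendsto (fun h => ρ h / ρ₀ h) (𝓝[>] 0) (𝓝 1)) (hs : 0 ≤ s) (hst : s < t) :
    ∀ᶠ x in 𝓝[>] 0, s * ρ₀ x ≤ t * ρ x := by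
  have ht : 0 < t := hs.trans_lt hst
  filter_upwards [h.eventually_const_lt ((div_lt_one ht).2 hst), Ioc_mem_nhdsGT zero_lt_one]
    with x hx hx1
  rcases (hρ₀.nonneg (Set.Ioc_subset_Icc_self hx1)).eq_or_lt with h0 | h0
  · rw [← h0, div_zero] at hx
    exact absurd hx (div_nonneg hs ht.le).not_gt
  · rw [div_lt_div_iff₀ ht h0, mul_comm (ρ x)] at hx
    exact hx.le

end Gauge

section LocalModulus

variable {E : Type*} [PseudoMetricSpace E] {ρ ρ₀ : ℝ → ℝ} {p K s t h r : ℝ} {f : I → E}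

/-- Over distances at most `h`, the increments of `f` are at most `t * ρ`. For `E = ℝ` this is
`localHolder ρ h f ≤ t`. -/
def HasLocalModulus (ρ : ℝ → ℝ) (t h : ℝ) (f : I → E) : Prop :=
  ∀ u v : I, dist u v ≤ h → dist (f u) (f v) ≤ t * ρ (dist u v)

theorem HasLocalModulus.anti (hf : HasLocalModulus ρ t h f) (hr : r ≤ h) :
    HasLocalModulus ρ t r f :=
  fun u v huv => hf u v (huv.trans hr)

theorem HasLocalModulus.change_gauge (hf : HasLocalModulus ρ₀ s h f) (hρ : ρ 0 = 0)
    (hle : ∀ x ∈ Set.Ioc 0 h, s * ρ₀ x ≤ t * ρ x) : HasLocalModulus ρ t h f := by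
  intro u v huv
  rcases eq_or_ne u v with rfl | hne
  · simp [hρ]
  · exact (hf u v huv).trans (hle _ ⟨dist_pos.2 hne, huv⟩)

theorem exists_hasLocalModulus_of_eventually_le (E : Type*) [PseudoMetricSpace E] (hρ : ρ 0 = 0)
    (hle : ∀ᶠ x in 𝓝[>] 0, s * ρ₀ x ≤ t * ρ x) (hh : 0 < h) :
    ∃ r, 0 < r ∧ ∀ f : I → E, HasLocalModulus ρ₀ s h f → HasLocalModulus ρ t r f := by
  obtain ⟨r, hr, hsub⟩ := mem_nhdsGT_iff_exists_Ioc_subset.1 hle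
  exact ⟨min r h, lt_min hr hh, fun f hf => (hf.anti (min_le_right r h)).change_gauge hρ
    fun x hx => hsub ⟨hx.1, hx.2.trans (min_le_left r h)⟩⟩

theorem IsPowerGauge.equicontinuous_of_hasLocalModulus (hρ : IsPowerGauge ρ p K) (hh : 0 < h)
    {ι : Type*} {F : ι → I → E} (hF : ∀ i, HasLocalModulus ρ t h (F i)) : Equicontinuous F := by
  intro v
  have hdist : Tendsto (fun u => dist v u) (𝓝 v) (𝓝 0) :=
    (continuous_const.dist continuous_id).tendsto' v 0 (dist_self v)
  have hgauge := (hρ.tendsto_zero hdist (dist_mem_Icc v)).const_mul t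
  rw [mul_zero] at hgauge
  refine Metric.equicontinuousAt_of_continuity_modulus _ hgauge F ?_
  filter_upwards [hdist.eventually_le_const hh] with u hu i using hF i v u hu

/-- The point dividing the segment from `u` to `v` in the ratio `k : n - k`, truncated at the ends
of the unit interval for `k > n`. -/
noncomputable def segmentPt (u v : I) (n k : ℕ) : I :=
  Set.projIcc 0 1 zero_le_one ((u : ℝ) + k / n * (v - u))

theorem segmentPt_zero (u v : I) (n : ℕ) : segmentPt u v n 0 = u := by
  simp [segmentPt]

theorem segmentPt_self (u v : I) {n : ℕ} (hn : (n : ℝ) ≠ 0) : segmentPt u v n n = v := by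
  rw [segmentPt, div_self hn, one_mul, add_sub_cancel, Set.projIcc_val]

theorem dist_segmentPt_succ_le (u v : I) (n k : ℕ) :
    dist (segmentPt u v n k) (segmentPt u v n (k + 1)) ≤ 1 / n := by
  refine (Set.abs_projIcc_sub_projIcc zero_le_one).trans ?_
  rw [show (u : ℝ) + k / n * (v - u) - (u + (k + 1 : ℕ) / n * (v - u)) = 1 / n * (u - v) by
    push_cast; ring, abs_mul, abs_of_nonneg (by positivity)]
  exact mul_le_of_le_one_right (by positivity) (dist_mem_Icc u v).2

theorem HasLocalModulus.dist_le (hf : HasLocalModulus ρ t h f) (hρ : MonotoneOn ρ (Set.Icc 0 1))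
    (ht : 0 ≤ t) (hh : 0 < h) (u v : I) : dist (f u) (f v) ≤ ⌈1 / h⌉₊ * (t * ρ 1) := by
  have hn : (0 : ℝ) < ⌈1 / h⌉₊ := Nat.cast_pos.2 (Nat.ceil_pos.2 (by positivity))
  have hstep (k : ℕ) : dist (f (segmentPt u v ⌈1 / h⌉₊ k)) (f (segmentPt u v ⌈1 / h⌉₊ (k + 1))) ≤
      t * ρ 1 := by
    have hdist := (dist_segmentPt_succ_le u v ⌈1 / h⌉₊ k).trans
      ((one_div_le hn hh).2 (Nat.le_ceil _))
    have hmem := dist_mem_Icc (segmentPt u v ⌈1 / h⌉₊ k) (segmentPt u v ⌈1 / h⌉₊ (k + 1))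
    exact (hf _ _ hdist).trans (mul_le_mul_of_nonneg_left (hρ hmem (by simp) hmem.2) ht)
  have hsum := dist_le_range_sum_of_dist_le (f := fun k => f (segmentPt u v ⌈1 / h⌉₊ k)) ⌈1 / h⌉₊
    fun {k} _ => hstep k
  simpa only [segmentPt_zero, segmentPt_self u v hn.ne', Finset.sum_const, Finset.card_range,
    nsmul_eq_mul] using hsum

theorem weightedIncr_le_ofReal_iff {f : I → ℝ} {u v : I} (hρ : 0 ≤ ρ (dist u v)) (ht : 0 ≤ t) :
    weightedIncr ρ f u v ≤ ENNReal.ofReal t ↔ dist (f u) (f v) ≤ t * ρ (dist u v) := by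
  rw [weightedIncr, ENNReal.div_le_iff_le_mul (Or.inr ENNReal.ofReal_ne_top)
    (Or.inl ENNReal.ofReal_ne_top), ← ENNReal.ofReal_mul ht, Real.enorm_eq_ofReal_abs]
  exact ENNReal.ofReal_le_ofReal_iff (mul_nonneg ht hρ)

theorem localHolder_le_ofReal_iff {f : I → ℝ} (hρ : ∀ x ∈ Set.Icc (0 : ℝ) 1, 0 ≤ ρ x)
    (ht : 0 ≤ t) : localHolder ρ h f ≤ ENNReal.ofReal t ↔ HasLocalModulus ρ t h f := by
  simp only [localHolder, iSup_le_iff]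
  exact forall₃_congr fun u v _ => weightedIncr_le_ofReal_iff (hρ _ (dist_mem_Icc u v)) ht

theorem holderSeminorm_le_ofReal_iff {f : I → ℝ} (hρ : ∀ x ∈ Set.Icc (0 : ℝ) 1, 0 ≤ ρ x)
    (ht : 0 ≤ t) :
    holderSeminorm ρ f ≤ ENNReal.ofReal t ↔ ∀ u v, dist (f u) (f v) ≤ t * ρ (dist u v) := by
  simp only [holderSeminorm, iSup_le_iff]
  exact forall₂_congr fun u v => weightedIncr_le_ofReal_iff (hρ _ (dist_mem_Icc u v)) ht

theorem IsModulus.exists_holderSeminorm_le (hρ : IsModulus ρ) (ht : 0 ≤ t) (hr : 0 < r) :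
    ∃ M : ℝ, ∀ f : I → ℝ, HasLocalModulus ρ t r f → holderSeminorm ρ f ≤ ENNReal.ofReal M := by
  have hmin : min r 1 ∈ Set.Ioc (0 : ℝ) 1 := ⟨lt_min hr zero_lt_one, min_le_right r 1⟩
  have hpos : 0 < ρ (min r 1) := hρ.pos _ hmin
  have hρ1 : 0 ≤ ρ 1 := hρ.nonneg (by simp)
  refine ⟨t + ⌈1 / r⌉₊ * (t * ρ 1) / ρ (min r 1), fun f hf =>
    (holderSeminorm_le_ofReal_iff (fun x => hρ.nonneg) (by positivity)).2 fun u v => ?_⟩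
  have huv := dist_mem_Icc u v
  have hρuv := hρ.nonneg huv
  rw [add_mul]
  rcases le_or_gt (dist u v) r with hle | hlt
  · exact le_add_of_le_of_nonneg (hf u v hle) (by positivity)
  · refine le_add_of_nonneg_of_le (by positivity) ((hf.dist_le hρ.monotoneOn ht hr u v).trans ?_)
    rw [div_mul_eq_mul_div, le_div_iff₀ hpos]
    exact mul_le_mul_of_nonneg_left
      (hρ.monotoneOn (Set.Ioc_subset_Icc_self hmin) huv ((min_le_left r 1).trans hlt.le))
      (by positivity)

theorem IsModulus.tendsto_localHolder_zero_iff (hρ : IsModulus ρ) {f : I → ℝ} :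
    Tendsto (fun δ => localHolder ρ δ f) (𝓝[>] 0) (𝓝 0) ↔
      ∀ ε : ℝ, 0 < ε → ∃ r, 0 < r ∧ HasLocalModulus ρ ε r f := by
  rw [ENNReal.tendsto_nhds_zero]
  constructor
  · intro hlim ε hε
    obtain ⟨r, hr, hr0⟩ := ((hlim _ (ENNReal.ofReal_pos.2 hε)).and self_mem_nhdsWithin).exists
    exact ⟨r, hr0, (localHolder_le_ofReal_iff (fun x => hρ.nonneg) hε.le).1 hr⟩
  · intro hmod ε hε
    obtain ⟨e, he0, heε⟩ := ENNReal.lt_iff_exists_nnreal_btwn.1 hε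
    have he : (0 : ℝ) < e := by exact_mod_cast he0
    obtain ⟨r, hr0, hr⟩ := hmod e he
    filter_upwards [Ioc_mem_nhdsGT hr0] with δ hδ
    refine le_trans ?_ heε.le
    rw [← ENNReal.ofReal_coe_nnreal]
    exact (localHolder_le_ofReal_iff (fun x => hρ.nonneg) he.le).2 (hr.anti hδ.2)

end LocalModulus

section Dyadic

/-- The dyadic point `a / 2 ^ m` of the unit interval, truncated at `1`. -/
noncomputable def dyadicPt (m a : ℕ) : I :=
  Set.projIcc 0 1 zero_le_one ((a : ℝ) / 2 ^ m)

/-- The largest dyadic point of level `m` below `u`. -/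
noncomputable def dyadicDown (m : ℕ) (u : I) : I :=
  dyadicPt m ⌊(u : ℝ) * 2 ^ m⌋₊

/-- The smallest dyadic point of level `m` above `u`. -/
noncomputable def dyadicUp (m : ℕ) (u : I) : I :=
  dyadicPt m ⌈(u : ℝ) * 2 ^ m⌉₊

theorem coe_dyadicPt {m a : ℕ} (h : a ≤ 2 ^ m) : (dyadicPt m a : ℝ) = a / 2 ^ m := by
  have h' : (a : ℝ) ≤ 2 ^ m := by exact_mod_cast h
  rw [dyadicPt, Set.projIcc_of_mem _ ⟨by positivity, div_le_one_of_le₀ h' (by positivity)⟩]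

theorem dyadicPt_succ (m a : ℕ) : dyadicPt (m + 1) (2 * a) = dyadicPt m a := by
  unfold dyadicPt
  congr 1
  push_cast
  rw [pow_succ']
  exact mul_div_mul_left _ _ two_ne_zero

theorem dist_dyadicPt_le (m a b : ℕ) :
    dist (dyadicPt m a) (dyadicPt m b) ≤ |(a : ℝ) - b| / 2 ^ m := by
  refine (Set.abs_projIcc_sub_projIcc zero_le_one).trans_eq ?_
  rw [← sub_div, abs_div, abs_of_pos (a := (2 : ℝ) ^ m) (by positivity)]

theorem dist_dyadicPt_of_le {m a b : ℕ} (hab : a ≤ b) (hb : b ≤ 2 ^ m) :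
    dist (dyadicPt m a) (dyadicPt m b) = ((b : ℝ) - a) / 2 ^ m := by
  have hab' : (a : ℝ) ≤ b := by exact_mod_cast hab
  rw [dist_comm, Subtype.dist_eq, Real.dist_eq, coe_dyadicPt hb, coe_dyadicPt (hab.trans hb),
    ← sub_div, abs_of_nonneg (div_nonneg (sub_nonneg.2 hab') (by positivity))]

variable (m : ℕ) (u : I)

theorem ceil_mul_two_pow_le : ⌈(u : ℝ) * 2 ^ m⌉₊ ≤ 2 ^ m := by
  rw [Nat.ceil_le]
  push_cast
  exact mul_le_of_le_one_left (by positivity) u.2.2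

theorem floor_mul_two_pow_le : ⌊(u : ℝ) * 2 ^ m⌋₊ ≤ 2 ^ m :=
  (Nat.floor_le_ceil _).trans (ceil_mul_two_pow_le m u)

theorem coe_dyadicUp : (dyadicUp m u : ℝ) = ⌈(u : ℝ) * 2 ^ m⌉₊ / 2 ^ m :=
  coe_dyadicPt (ceil_mul_two_pow_le m u)

theorem coe_dyadicDown : (dyadicDown m u : ℝ) = ⌊(u : ℝ) * 2 ^ m⌋₊ / 2 ^ m :=
  coe_dyadicPt (floor_mul_two_pow_le m u)

theorem le_dyadicUp : (u : ℝ) ≤ dyadicUp m u := by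
  rw [coe_dyadicUp, le_div_iff₀ (by positivity)]
  exact Nat.le_ceil _

theorem dyadicUp_lt : (dyadicUp m u : ℝ) < u + (1 / 2) ^ m := by
  rw [coe_dyadicUp, div_lt_iff₀ (by positivity), add_mul, ← mul_pow, one_div_mul_cancel two_ne_zero,
    one_pow]
  exact Nat.ceil_lt_add_one (mul_nonneg u.2.1 (by positivity))

theorem dyadicDown_le : (dyadicDown m u : ℝ) ≤ u := by
  rw [coe_dyadicDown, div_le_iff₀ (by positivity)]
  exact Nat.floor_le (mul_nonneg u.2.1 (by positivity))

theorem lt_dyadicDown : (u : ℝ) - (1 / 2) ^ m < dyadicDown m u := by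
  rw [coe_dyadicDown, lt_div_iff₀ (by positivity), sub_mul, ← mul_pow,
    one_div_mul_cancel two_ne_zero, one_pow, sub_lt_iff_lt_add]
  exact Nat.lt_floor_add_one _

theorem dist_dyadicDown_self_le : dist (dyadicDown m u) u ≤ (1 / 2) ^ m :=
  abs_sub_le_iff.2 ⟨by linarith [dyadicDown_le m u, (half_pow_mem_Icc m).1],
    by linarith [lt_dyadicDown m u]⟩

theorem tendsto_half_pow : Tendsto (fun m : ℕ => ((1 : ℝ) / 2) ^ m) atTop (𝓝 0) :=
  tendsto_pow_atTop_nhds_zero_of_lt_one (by norm_num) (by norm_num)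

theorem tendsto_dyadicDown : Tendsto (fun m => dyadicDown m u) atTop (𝓝 u) :=
  tendsto_iff_dist_tendsto_zero.2 <| squeeze_zero (fun _ => dist_nonneg)
    (fun m => dist_dyadicDown_self_le m u) tendsto_half_pow

theorem tendsto_dyadicUp : Tendsto (fun m => dyadicUp m u) atTop (𝓝 u) := by
  rw [tendsto_subtype_rng]
  refine tendsto_of_tendsto_of_tendsto_of_le_of_le (h := fun m : ℕ => (u : ℝ) + (1 / 2) ^ m)
    tendsto_const_nhds ?_ (fun m => le_dyadicUp m u) fun m => (dyadicUp_lt m u).le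
  simpa only [add_zero] using tendsto_half_pow.const_add (u : ℝ)

end Dyadic

section Chaining

variable {E : Type*} [PseudoMetricSpace E] {ρ : ℝ → ℝ} {p K s t : ℝ} {N j m n : ℕ} {f g : I → E}

/-- At every level `m ≥ j`, the increments of `f` between dyadic points at most `2 ^ N` grid steps
apart are at most `s * ρ`. The number of steps is written as `d + 1`. -/
def HasDyadicModulus (ρ : ℝ → ℝ) (s : ℝ) (N j : ℕ) (f : I → E) : Prop :=
  ∀ m, j ≤ m → ∀ a < 2 ^ m, ∀ d < 2 ^ N, dist (f (dyadicPt m a)) (f (dyadicPt m (a + d + 1))) ≤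
    s * ρ (dist (dyadicPt m a) (dyadicPt m (a + d + 1)))

theorem HasDyadicModulus.dist_le (h : HasDyadicModulus ρ s N j f) {a b : ℕ} (hm : j ≤ m)
    (hab : a < b) (hb : b ≤ 2 ^ m) (hN : b ≤ a + 2 ^ N) :
    dist (f (dyadicPt m a)) (f (dyadicPt m b)) ≤ s * ρ (dist (dyadicPt m a) (dyadicPt m b)) := by
  have hstep := h m hm a (by omega) (b - a - 1) (by omega)
  rwa [show a + (b - a - 1) + 1 = b by omega] at hstep

theorem HasDyadicModulus.dist_le_of_le_succ (h : HasDyadicModulus ρ s N j f)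
    (hρ : IsPowerGauge ρ p K) (hs : 0 ≤ s) {a b : ℕ} (hm : j ≤ m) (hab : a ≤ b) (hb : b ≤ 2 ^ m)
    (hba : b ≤ a + 1) : dist (f (dyadicPt m a)) (f (dyadicPt m b)) ≤ s * ρ ((1 / 2) ^ m) := by
  rcases hab.eq_or_lt with rfl | hlt
  · rw [dist_self]
    exact mul_nonneg hs (hρ.nonneg (half_pow_mem_Icc m))
  · obtain rfl : b = a + 1 := by omega
    have hdist := h.dist_le hm hlt hb (by have := Nat.one_le_two_pow (n := N); omega)
    rwa [dist_dyadicPt_of_le hab hb, Nat.cast_succ, add_sub_cancel_left, ← one_div_pow] at hdist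

theorem HasDyadicModulus.dist_dyadicUp_succ_le (h : HasDyadicModulus ρ s N j f)
    (hρ : IsPowerGauge ρ p K) (hs : 0 ≤ s) (hm : j ≤ m) (u : I) :
    dist (f (dyadicUp m u)) (f (dyadicUp (m + 1) u)) ≤ s * ρ ((1 / 2) ^ (m + 1)) := by
  have hdouble : (u : ℝ) * 2 ^ (m + 1) = 2 * (u * 2 ^ m) := by ring
  rw [dyadicUp, ← dyadicPt_succ, dist_comm]
  refine h.dist_le_of_le_succ hρ hs (by omega) ?_ ?_ ?_
  · rw [Nat.ceil_le, hdouble]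
    push_cast
    linarith [Nat.le_ceil ((u : ℝ) * 2 ^ m)]
  · rw [pow_succ']
    exact Nat.mul_le_mul_left 2 (ceil_mul_two_pow_le m u)
  · have hlt : ((2 * ⌈(u : ℝ) * 2 ^ m⌉₊ : ℕ) : ℝ) < ((⌈(u : ℝ) * 2 ^ (m + 1)⌉₊ + 2 : ℕ) : ℝ) := by
      push_cast
      linarith [Nat.ceil_lt_add_one (mul_nonneg u.2.1 (by positivity : (0 : ℝ) ≤ 2 ^ m)),
        Nat.le_ceil ((u : ℝ) * 2 ^ (m + 1))]
    have := Nat.cast_lt.1 hlt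
    omega

theorem HasDyadicModulus.dist_dyadicDown_succ_le (h : HasDyadicModulus ρ s N j f)
    (hρ : IsPowerGauge ρ p K) (hs : 0 ≤ s) (hm : j ≤ m) (u : I) :
    dist (f (dyadicDown m u)) (f (dyadicDown (m + 1) u)) ≤ s * ρ ((1 / 2) ^ (m + 1)) := by
  have hdouble : (u : ℝ) * 2 ^ (m + 1) = 2 * (u * 2 ^ m) := by ring
  rw [dyadicDown, ← dyadicPt_succ]
  refine h.dist_le_of_le_succ hρ hs (by omega) ?_ (floor_mul_two_pow_le _ u) ?_
  · refine Nat.le_floor ?_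
    rw [hdouble]
    push_cast
    linarith [Nat.floor_le (mul_nonneg u.2.1 (by positivity : (0 : ℝ) ≤ 2 ^ m))]
  · have hlt : ((⌊(u : ℝ) * 2 ^ (m + 1)⌋₊ : ℕ) : ℝ) < ((2 * ⌊(u : ℝ) * 2 ^ m⌋₊ + 2 : ℕ) : ℝ) := by
      push_cast
      linarith [Nat.lt_floor_add_one ((u : ℝ) * 2 ^ m),
        Nat.floor_le (mul_nonneg u.2.1 (by positivity : (0 : ℝ) ≤ 2 ^ (m + 1)))]
    have := Nat.cast_lt.1 hlt
    omega

theorem HasDyadicModulus.dist_dyadicDown_dyadicUp_le (h : HasDyadicModulus ρ s N j f)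
    (hρ : IsPowerGauge ρ p K) (hs : 0 ≤ s) (hm : j ≤ m) (u : I) :
    dist (f (dyadicDown m u)) (f (dyadicUp m u)) ≤ s * ρ ((1 / 2) ^ m) :=
  h.dist_le_of_le_succ hρ hs hm (Nat.floor_le_ceil _) (ceil_mul_two_pow_le m u)
    (Nat.ceil_le_floor_add_one _)

-- Both grid points lie between `u` and `v`, whose distance is at most `2 ^ N` steps of the grid.
theorem HasDyadicModulus.dist_dyadicUp_dyadicDown_le (h : HasDyadicModulus ρ s N j f)
    (hρ : MonotoneOn ρ (Set.Icc 0 1)) (hs : 0 ≤ s) (hN : 2 ≤ N) (hn : j ≤ n) {u v : I}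
    (hlt : (1 / 2) ^ (n + 1) < (v : ℝ) - u) (hle : (v : ℝ) - u ≤ (1 / 2) ^ n) :
    dist (f (dyadicUp (n + N) u)) (f (dyadicDown (n + N) v)) ≤ s * ρ (v - u) := by
  have hu := le_dyadicUp (n + N) u
  have hv := dyadicDown_le (n + N) v
  have hhalf : 2 * (1 / 2 : ℝ) ^ (n + N) ≤ (1 / 2) ^ (n + 1) := by
    have : (1 / 2 : ℝ) ^ (n + N) ≤ (1 / 2) ^ (n + 1 + 1) :=
      pow_le_pow_of_le_one (by norm_num) (by norm_num) (by omega)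
    linarith [pow_succ (1 / 2 : ℝ) (n + 1)]
  have hord : (dyadicUp (n + N) u : ℝ) < dyadicDown (n + N) v := by
    linarith [dyadicUp_lt (n + N) u, lt_dyadicDown (n + N) v]
  have hdist : dist (dyadicUp (n + N) u) (dyadicDown (n + N) v) ≤ v - u := by
    rw [dist_comm, Subtype.dist_eq, Real.dist_eq, abs_of_pos (sub_pos.2 hord)]
    linarith
  have hindex : ⌈(u : ℝ) * 2 ^ (n + N)⌉₊ < ⌊(v : ℝ) * 2 ^ (n + N)⌋₊ := by
    rw [coe_dyadicUp, coe_dyadicDown, div_lt_div_iff_of_pos_right (by positivity)] at hord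
    exact_mod_cast hord
  have hsteps : ⌊(v : ℝ) * 2 ^ (n + N)⌋₊ ≤ ⌈(u : ℝ) * 2 ^ (n + N)⌉₊ + 2 ^ N := by
    have hle' := hdist.trans hle
    have hscale : (1 / 2 : ℝ) ^ n * 2 ^ (n + N) = 2 ^ N := by
      rw [pow_add, ← mul_assoc, ← mul_pow, one_div_mul_cancel two_ne_zero, one_pow, one_mul]
    rw [dyadicUp, dyadicDown, dist_dyadicPt_of_le hindex.le (floor_mul_two_pow_le _ v),
      div_le_iff₀ (by positivity), hscale, sub_le_iff_le_add'] at hle'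
    exact_mod_cast hle'
  refine (h.dist_le (m := n + N) (by omega) hindex (floor_mul_two_pow_le _ v) hsteps).trans
    (mul_le_mul_of_nonneg_left (hρ (dist_mem_Icc _ _) ?_ hdist) hs)
  exact ⟨dist_nonneg.trans hdist, by linarith [u.2.1, v.2.2]⟩

theorem dist_le_of_le_geometric_of_lt_one {x : ℕ → E} {B q : ℝ} (hB : 0 ≤ B) (hq0 : 0 ≤ q)
    (hq1 : q < 1) (hx : ∀ k, dist (x k) (x (k + 1)) ≤ B * q ^ k) (k : ℕ) :
    dist (x 0) (x k) ≤ B / (1 - q) := by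
  refine (dist_le_range_sum_of_dist_le k fun {i} _ => hx i).trans ?_
  rw [← Finset.mul_sum, div_eq_mul_inv, ← tsum_geometric_of_lt_one hq0 hq1]
  exact mul_le_mul_of_nonneg_left
    ((summable_geometric_of_lt_one hq0 hq1).sum_le_tsum _ fun i _ => pow_nonneg hq0 i) hB

theorem IsPowerGauge.dist_le_of_dist_succ_le (hρ : IsPowerGauge ρ p K) (hs : 0 ≤ s) {x : ℕ → E}
    (hx : ∀ m, n + N ≤ m → dist (x m) (x (m + 1)) ≤ s * ρ ((1 / 2) ^ (m + 1))) (k : ℕ) :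
    dist (x (n + N)) (x (n + N + k)) ≤
      s * (K * ((1 / 2) ^ p) ^ N / (1 - (1 / 2) ^ p)) * ρ ((1 / 2) ^ (n + 1)) := by
  have hq := half_rpow_pos p
  have hK := hρ.K_pos
  have hρn := hρ.nonneg (half_pow_mem_Icc (n + 1))
  have hgeom := dist_le_of_le_geometric_of_lt_one (x := fun k => x (n + N + k))
    (B := s * (K * ((1 / 2) ^ p) ^ N * ρ ((1 / 2) ^ (n + 1)))) (by positivity) hq.le
    (half_rpow_lt_one hρ.p_pos) (fun i => ?_) k
  · exact hgeom.trans_eq (by ring)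
  · refine (hx _ (by omega)).trans ?_
    rw [show n + N + i + 1 = n + 1 + (N + i) by ring]
    refine (mul_le_mul_of_nonneg_left (hρ.half_pow_add_le (n + 1) (N + i)) hs).trans_eq ?_
    ring

/-- The constant by which chaining along a power gauge enlarges the modulus on the dyadic grids,
when jumps of up to `2 ^ N` grid steps are controlled there. -/
noncomputable def chainingFactor (p K : ℝ) (N : ℕ) : ℝ :=
  1 + 2 * (K * ((1 / 2) ^ p) ^ N / (1 - (1 / 2) ^ p))

theorem tendsto_chainingFactor (hp : 0 < p) :
    Tendsto (fun N => chainingFactor p K N) atTop (𝓝 1) := by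
  unfold chainingFactor
  have hpow := tendsto_pow_atTop_nhds_zero_of_lt_one (half_rpow_pos p).le (half_rpow_lt_one hp)
  simpa using (((hpow.const_mul K).div_const (1 - (1 / 2 : ℝ) ^ p)).const_mul 2).const_add 1

theorem exists_mul_chainingFactor_le (hp : 0 < p) (K : ℝ) (hst : s < t) :
    ∃ N, 2 ≤ N ∧ s * chainingFactor p K N ≤ t := by
  have hlim := (tendsto_chainingFactor (K := K) hp).const_mul s
  rw [mul_one] at hlim
  exact ((eventually_ge_atTop 2).and (hlim.eventually_le_const hst)).exists

theorem HasDyadicModulus.eventually_dist_dyadicUp_dyadicDown_le (h : HasDyadicModulus ρ s N j f)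
    (hρ : IsPowerGauge ρ p K) (hs : 0 ≤ s) (hN : 2 ≤ N) {u v : I} (huv : (u : ℝ) < v)
    (hj : (v : ℝ) - u ≤ (1 / 2) ^ j) :
    ∀ᶠ m in atTop, dist (f (dyadicUp m u)) (f (dyadicDown m v)) ≤
      s * chainingFactor p K N * ρ (v - u) := by
  obtain ⟨n, hn_lt, hn_le⟩ := exists_nat_pow_near_of_lt_one (sub_pos.2 huv)
    (by linarith [u.2.1, v.2.2]) (by norm_num : (0 : ℝ) < 1 / 2) (by norm_num)
  have hjn : j ≤ n := Nat.lt_succ_iff.1 <|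
    (pow_lt_pow_iff_right_of_lt_one₀ (by norm_num : (0 : ℝ) < 1 / 2) (by norm_num)).1
      (hn_lt.trans_le hj)
  have hmono : ρ ((1 / 2) ^ (n + 1)) ≤ ρ (v - u) := hρ.monotoneOn (half_pow_mem_Icc (n + 1))
    ⟨by linarith, by linarith [u.2.1, v.2.2]⟩ hn_lt.le
  have hq : 0 < 1 - (1 / 2 : ℝ) ^ p := sub_pos.2 (half_rpow_lt_one hρ.p_pos)
  have hcoeff : 0 ≤ s * (K * ((1 / 2) ^ p) ^ N / (1 - (1 / 2) ^ p)) := by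
    have := hρ.K_pos
    positivity
  filter_upwards [eventually_ge_atTop (n + N)] with m hm
  obtain ⟨k, rfl⟩ := Nat.exists_eq_add_of_le hm
  have hup := (hρ.dist_le_of_dist_succ_le (x := fun m => f (dyadicUp m u)) hs
    (fun m hm => h.dist_dyadicUp_succ_le hρ hs (by omega) u) k).trans
      (mul_le_mul_of_nonneg_left hmono hcoeff)
  have hmid := h.dist_dyadicUp_dyadicDown_le hρ.monotoneOn hs hN hjn hn_lt hn_le
  have hdown := (hρ.dist_le_of_dist_succ_le (x := fun m => f (dyadicDown m v)) hs
    (fun m hm => h.dist_dyadicDown_succ_le hρ hs (by omega) v) k).trans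
      (mul_le_mul_of_nonneg_left hmono hcoeff)
  rw [dist_comm] at hup
  refine (dist_triangle4 _ _ _ _).trans ((add_le_add_three hup hmid hdown).trans_eq ?_)
  rw [chainingFactor]
  ring

theorem HasDyadicModulus.hasLocalModulus_of_tendsto (h : HasDyadicModulus ρ s N j f)
    (hρ : IsPowerGauge ρ p K) (hs : 0 ≤ s) (hN : 2 ≤ N) (ht : s * chainingFactor p K N ≤ t)
    (hup : ∀ u, Tendsto (fun m => f (dyadicUp m u)) atTop (𝓝 (g u)))
    (hdown : ∀ u, Tendsto (fun m => f (dyadicDown m u)) atTop (𝓝 (g u))) :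
    HasLocalModulus ρ t ((1 / 2) ^ j) g := by
  intro u v huv
  have hρuv := hρ.nonneg (dist_mem_Icc u v)
  wlog hle : (u : ℝ) ≤ v generalizing u v
  · rw [dist_comm u] at huv hρuv
    rw [dist_comm, dist_comm u]
    exact this v u huv hρuv (le_of_not_ge hle)
  rcases hle.eq_or_lt with heq | hlt
  · rw [Subtype.ext heq, dist_self, dist_self, hρ.map_zero, mul_zero]
  rw [dist_comm u, Subtype.dist_eq, Real.dist_eq, abs_of_pos (sub_pos.2 hlt)] at huv hρuv ⊢
  refine le_of_tendsto ((hup u).dist (hdown v)) ?_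
  filter_upwards [h.eventually_dist_dyadicUp_dyadicDown_le hρ hs hN hlt huv] with m hm
  exact hm.trans (mul_le_mul_of_nonneg_right ht hρuv)

theorem HasDyadicModulus.hasLocalModulus_of_continuous (h : HasDyadicModulus ρ s N j f)
    (hρ : IsPowerGauge ρ p K) (hs : 0 ≤ s) (hN : 2 ≤ N) (ht : s * chainingFactor p K N ≤ t)
    (hf : Continuous f) : HasLocalModulus ρ t ((1 / 2) ^ j) f :=
  h.hasLocalModulus_of_tendsto hρ hs hN ht (fun u => (hf.tendsto u).comp (tendsto_dyadicUp u))
    fun u => (hf.tendsto u).comp (tendsto_dyadicDown u)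

end Chaining

section Tails

variable {E : Type*} [PseudoMetricSpace E] {Ω : Type*} [MeasurableSpace Ω] {P : Measure Ω}
  {W : I → Ω → E} {ρ : ℝ → ℝ} {p s κ K K' : ℝ}

/-- The increments of the process `W` over a distance `x` exceed `s * ρ x` with probability at most
`K * x ^ κ`; this is the hypothesis (T) on a single process, with its constants as parameters. -/
def HasIncrTail (P : Measure Ω) (W : I → Ω → E) (ρ : ℝ → ℝ) (s κ K : ℝ) : Prop :=
  ∀ u v : I, P {ω | s * ρ (dist u v) < dist (W u ω) (W v ω)} ≤ ENNReal.ofReal (K * dist u v ^ κ)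

/-- The union bound for the probability that one of the `2 ^ m * 2 ^ N` increments of level `m`
considered in `HasDyadicModulus` is too large. -/
noncomputable def dyadicLevelBound (κ K : ℝ) (N m : ℕ) : ℝ≥0∞ :=
  ENNReal.ofReal (2 ^ m * (2 ^ N * (K * (2 ^ N / 2 ^ m) ^ κ)))

theorem tsum_dyadicLevelBound_ne_top (hκ : 1 < κ) (K : ℝ) (N : ℕ) :
    ∑' m, dyadicLevelBound κ K N m ≠ ∞ := by
  have hq : (2 : ℝ) * (1 / 2) ^ κ < 1 := by
    have := Real.rpow_lt_rpow_of_exponent_gt (by norm_num : (0 : ℝ) < 1 / 2) (by norm_num) hκ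
    rw [Real.rpow_one] at this
    linarith
  have hgeom := (summable_geometric_of_lt_one (by positivity) hq).mul_left
    (2 ^ N * K * ((2 : ℝ) ^ N) ^ κ)
  refine (hgeom.congr fun m => ?_).tsum_ofReal_ne_top
  have hpow : ((2 : ℝ) ^ N / 2 ^ m) ^ κ = (2 ^ N) ^ κ * ((1 / 2) ^ κ) ^ m := by
    rw [div_eq_mul_one_div, ← one_div_pow, Real.mul_rpow (by positivity) (by positivity),
      half_pow_rpow]
  rw [hpow, mul_pow]
  ring

theorem tendsto_tsum_dyadicLevelBound_add (hκ : 1 < κ) (K : ℝ) (N : ℕ) :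
    Tendsto (fun j => ∑' k, dyadicLevelBound κ K N (k + j)) atTop (𝓝 0) :=
  ENNReal.tendsto_sum_nat_add _ (tsum_dyadicLevelBound_ne_top hκ K N)

theorem HasIncrTail.measure_lt_dist_dyadicPt_le (h : HasIncrTail P W ρ s κ K) (hκ : 0 ≤ κ)
    (hK : 0 ≤ K) (m a : ℕ) {N d : ℕ} (hd : d < 2 ^ N) :
    P {ω | s * ρ (dist (dyadicPt m a) (dyadicPt m (a + d + 1))) <
      dist (W (dyadicPt m a) ω) (W (dyadicPt m (a + d + 1)) ω)} ≤
        ENNReal.ofReal (K * (2 ^ N / 2 ^ m) ^ κ) := by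
  have hd' : ((d + 1 : ℕ) : ℝ) ≤ 2 ^ N := by exact_mod_cast hd
  have hdist : dist (dyadicPt m a) (dyadicPt m (a + d + 1)) ≤ 2 ^ N / 2 ^ m := by
    refine (dist_dyadicPt_le m a (a + d + 1)).trans ?_
    gcongr
    rw [abs_sub_comm, abs_le]
    push_cast at hd' ⊢
    constructor <;> linarith [(d.cast_nonneg : (0 : ℝ) ≤ d)]
  exact (h _ _).trans (ENNReal.ofReal_le_ofReal (mul_le_mul_of_nonneg_left
    (Real.rpow_le_rpow dist_nonneg hdist hκ) hK))

theorem HasIncrTail.measure_not_hasDyadicModulus_le (h : HasIncrTail P W ρ s κ K) (hκ : 0 ≤ κ)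
    (hK : 0 ≤ K) (N j : ℕ) :
    P {ω | ¬ HasDyadicModulus ρ s N j fun u => W u ω} ≤ ∑' k, dyadicLevelBound κ K N (k + j) := by
  have hsub : {ω | ¬ HasDyadicModulus ρ s N j fun u => W u ω} ⊆
      ⋃ k : ℕ, ⋃ a ∈ Finset.range (2 ^ (k + j)), ⋃ d ∈ Finset.range (2 ^ N),
        {ω | s * ρ (dist (dyadicPt (k + j) a) (dyadicPt (k + j) (a + d + 1))) <
          dist (W (dyadicPt (k + j) a) ω) (W (dyadicPt (k + j) (a + d + 1)) ω)} := by
    intro ω hω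
    simp only [HasDyadicModulus, Set.mem_ofPred_eq, not_forall, not_le] at hω
    obtain ⟨m, hm, a, ha, d, hd, hlt⟩ := hω
    obtain ⟨k, rfl⟩ := Nat.exists_eq_add_of_le' hm
    simp only [Set.mem_iUnion, Finset.mem_range]
    exact ⟨k, a, ha, d, hd, hlt⟩
  refine (measure_mono hsub).trans ((measure_iUnion_le _).trans (ENNReal.tsum_le_tsum fun k => ?_))
  calc
    _ ≤ ∑ _a ∈ Finset.range (2 ^ (k + j)), ∑ _d ∈ Finset.range (2 ^ N),
          ENNReal.ofReal (K * (2 ^ N / 2 ^ (k + j)) ^ κ) :=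
      (measure_biUnion_finset_le _ _).trans <| Finset.sum_le_sum fun a _ =>
        (measure_biUnion_finset_le _ _).trans <| Finset.sum_le_sum fun d hd =>
          h.measure_lt_dist_dyadicPt_le hκ hK (k + j) a (Finset.mem_range.1 hd)
    _ = dyadicLevelBound κ K N (k + j) := by
      have hpow (i : ℕ) : ((2 ^ i : ℕ) : ℝ≥0∞) = ENNReal.ofReal (2 ^ i) := by
        rw [← ENNReal.ofReal_natCast]
        push_cast
        rfl
      simp only [Finset.sum_const, Finset.card_range, nsmul_eq_mul, dyadicLevelBound, hpow]
      rw [ENNReal.ofReal_mul (p := 2 ^ (k + j)) (by positivity),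
        ENNReal.ofReal_mul (p := 2 ^ N) (by positivity)]

theorem HasIncrTail.ae_exists_hasDyadicModulus (h : HasIncrTail P W ρ s κ K) (hκ : 1 < κ)
    (hK : 0 ≤ K) (N : ℕ) : ∀ᵐ ω ∂P, ∃ j, HasDyadicModulus ρ s N j fun u => W u ω := by
  refine le_antisymm (ge_of_tendsto' (tendsto_tsum_dyadicLevelBound_add hκ K N) fun j => ?_)
    zero_le
  refine (measure_mono fun ω hω => ?_).trans
    (h.measure_not_hasDyadicModulus_le (zero_le_one.trans hκ.le) hK N j)
  exact fun hj => hω ⟨j, hj⟩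

theorem HasIncrTail.ae_tendsto_dyadicDown (h : HasIncrTail P W ρ s κ K)
    (hρ : IsPowerGauge ρ p K') (hs : 0 ≤ s) (hκ : 0 < κ) (hK : 0 ≤ K) (u : I) :
    ∀ᵐ ω ∂P, Tendsto (fun m => W (dyadicDown m u) ω) atTop (𝓝 (W u ω)) := by
  have hsum : ∑' m : ℕ, P {ω | s * ρ (dist (dyadicDown m u) u) <
      dist (W (dyadicDown m u) ω) (W u ω)} ≠ ∞ := by
    have hgeom := (summable_geometric_of_lt_one (half_rpow_pos κ).le (half_rpow_lt_one hκ)).mul_left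
      K
    refine ne_top_of_le_ne_top hgeom.tsum_ofReal_ne_top (ENNReal.tsum_le_tsum fun m => ?_)
    refine (h _ _).trans (ENNReal.ofReal_le_ofReal (mul_le_mul_of_nonneg_left ?_ hK))
    rw [← half_pow_rpow]
    exact Real.rpow_le_rpow dist_nonneg (dist_dyadicDown_self_le m u) hκ.le
  have hgauge := (hρ.tendsto_zero tendsto_half_pow half_pow_mem_Icc).const_mul s
  rw [mul_zero] at hgauge
  filter_upwards [ae_eventually_notMem hsum] with ω hω
  refine tendsto_iff_dist_tendsto_zero.2 (squeeze_zero' (.of_forall fun _ => dist_nonneg) ?_ hgauge)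
  filter_upwards [hω] with m hm
  exact (not_lt.1 hm).trans (mul_le_mul_of_nonneg_left
    (hρ.monotoneOn (dist_mem_Icc _ _) (half_pow_mem_Icc m) (dist_dyadicDown_self_le m u)) hs)

end Tails

section UniformModulus

variable {ι : Type*} {Ω : ι → Type*} [∀ i, MeasurableSpace (Ω i)] {P : ∀ i, Measure (Ω i)}
  {E : Type*} [PseudoMetricSpace E] {W : ∀ i, I → Ω i → E} {ρ ρ₀ : ℝ → ℝ} {p s t κ K K' : ℝ}

/-- As `h ↓ 0`, the paths of the processes `W i` have increments at most `t * ρ` over distances at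
most `h`, up to events of probability tending to `0` uniformly in `i`. -/
def UniformLocalModulus (P : ∀ i, Measure (Ω i)) (W : ∀ i, I → Ω i → E) (ρ : ℝ → ℝ) (t : ℝ) :
    Prop :=
  Tendsto (fun h => ⨆ i, P i {ω | ¬ HasLocalModulus ρ t h fun u => W i u ω}) (𝓝[>] 0) (𝓝 0)

theorem uniformLocalModulus_iff : UniformLocalModulus P W ρ t ↔ ∀ ε : ℝ≥0∞, 0 < ε →
    ∃ h, 0 < h ∧ ∀ i, P i {ω | ¬ HasLocalModulus ρ t h fun u => W i u ω} ≤ ε := by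
  rw [UniformLocalModulus, ENNReal.tendsto_nhds_zero]
  refine forall₂_congr fun ε _ => ⟨fun h => ?_, fun ⟨h, hh, hle⟩ => ?_⟩
  · obtain ⟨r, hr, hr0⟩ := (h.and self_mem_nhdsWithin).exists
    exact ⟨r, hr0, iSup_le_iff.1 hr⟩
  · filter_upwards [Ioc_mem_nhdsGT hh] with r hr
    refine iSup_le fun i => (measure_mono fun ω hω => ?_).trans (hle i)
    exact fun hmod => hω (hmod.anti hr.2)

theorem UniformLocalModulus.exists_measure_le (h : UniformLocalModulus P W ρ t) {ε : ℝ≥0∞}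
    (hε : 0 < ε) : ∃ r, 0 < r ∧ ∀ i, P i {ω | ¬ HasLocalModulus ρ t r fun u => W i u ω} ≤ ε :=
  uniformLocalModulus_iff.1 h ε hε

theorem UniformLocalModulus.ae_exists (h : UniformLocalModulus P W ρ t) (i : ι) :
    ∀ᵐ ω ∂(P i), ∃ r, 0 < r ∧ HasLocalModulus ρ t r fun u => W i u ω := by
  refine le_antisymm (le_of_forall_gt_imp_ge_of_dense fun ε hε => ?_) zero_le
  obtain ⟨r, hr0, hr⟩ := h.exists_measure_le hε
  refine (measure_mono fun ω hω => ?_).trans (hr i)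
  exact fun hmod => hω ⟨r, hr0, hmod⟩

theorem UniformLocalModulus.change_gauge (h : UniformLocalModulus P W ρ₀ s) (hρ : ρ 0 = 0)
    (hle : ∀ᶠ x in 𝓝[>] 0, s * ρ₀ x ≤ t * ρ x) : UniformLocalModulus P W ρ t := by
  refine uniformLocalModulus_iff.2 fun ε hε => ?_
  obtain ⟨r, hr0, hr⟩ := h.exists_measure_le hε
  obtain ⟨r', hr', hmod⟩ := exists_hasLocalModulus_of_eventually_le E hρ hle hr0
  refine ⟨r', hr', fun i => (measure_mono fun ω hω => ?_).trans (hr i)⟩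
  exact fun hf => hω (hmod _ hf)

theorem HasIncrTail.uniformLocalModulus (h : ∀ i, HasIncrTail (P i) (W i) ρ s κ K)
    (hρ : IsPowerGauge ρ p K') (hs : 0 ≤ s) (hst : s < t) (hκ : 1 < κ) (hK : 0 ≤ K)
    (hW : ∀ i ω, Continuous fun u => W i u ω) : UniformLocalModulus P W ρ t := by
  obtain ⟨N, hN, hNt⟩ := exists_mul_chainingFactor_le hρ.p_pos K' hst
  refine uniformLocalModulus_iff.2 fun ε hε => ?_
  obtain ⟨j, hj⟩ := ((tendsto_tsum_dyadicLevelBound_add hκ K N).eventually_le_const hε).exists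
  refine ⟨(1 / 2) ^ j, by positivity, fun i => (measure_mono fun ω hω => ?_).trans
    (((h i).measure_not_hasDyadicModulus_le (zero_le_one.trans hκ.le) hK N j).trans hj)⟩
  exact fun hmod => hω (hmod.hasLocalModulus_of_continuous hρ hs hN hNt (hW i ω))

end UniformModulus

section Modification

variable {E : Type*} [MetricSpace E] {ρ : ℝ → ℝ} {p s K : ℝ} {N j : ℕ} {f : I → E}

/-- The extension of `f` from the dyadic points to the unit interval, by approximation from below.
At points where the limit does not exist the value is junk. -/
noncomputable def dyadicLim (f : I → E) (u : I) : E :=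
  haveI : Nonempty E := ⟨f 0⟩
  limUnder atTop fun m => f (dyadicDown m u)

theorem HasDyadicModulus.tendsto_dyadicDown [CompleteSpace E] (h : HasDyadicModulus ρ s N j f)
    (hρ : IsPowerGauge ρ p K) (hs : 0 ≤ s) (u : I) :
    Tendsto (fun m => f (dyadicDown m u)) atTop (𝓝 (dyadicLim f u)) := by
  have hcauchy : CauchySeq fun k => f (dyadicDown (k + j) u) := by
    refine cauchySeq_of_le_geometric ((1 / 2) ^ p) (s * (K * (1 / 2) ^ p * ρ ((1 / 2) ^ j)))
      (half_rpow_lt_one hρ.p_pos) fun k => ?_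
    have hstep := h.dist_dyadicDown_succ_le hρ hs (Nat.le_add_left j k) u
    rw [add_right_comm k 1 j]
    rw [show k + j + 1 = j + (k + 1) by ring] at hstep ⊢
    refine hstep.trans ((mul_le_mul_of_nonneg_left (hρ.half_pow_add_le j (k + 1)) hs).trans_eq ?_)
    ring
  obtain ⟨y, hy⟩ := cauchySeq_tendsto_of_complete hcauchy
  exact tendsto_nhds_limUnder ⟨y, (tendsto_add_atTop_iff_nat j).1 hy⟩

theorem HasDyadicModulus.tendsto_dyadicUp [CompleteSpace E] (h : HasDyadicModulus ρ s N j f)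
    (hρ : IsPowerGauge ρ p K) (hs : 0 ≤ s) (u : I) :
    Tendsto (fun m => f (dyadicUp m u)) atTop (𝓝 (dyadicLim f u)) := by
  have hgauge := (hρ.tendsto_zero tendsto_half_pow half_pow_mem_Icc).const_mul s
  rw [mul_zero] at hgauge
  refine (tendsto_iff_of_dist ?_).1 (h.tendsto_dyadicDown hρ hs u)
  refine squeeze_zero' (.of_forall fun _ => dist_nonneg) ?_ hgauge
  filter_upwards [eventually_ge_atTop j] with m hm using h.dist_dyadicDown_dyadicUp_le hρ hs hm u

theorem HasDyadicModulus.continuous_dyadicLim [CompleteSpace E] (h : HasDyadicModulus ρ s N j f)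
    (hρ : IsPowerGauge ρ p K) (hs : 0 ≤ s) (hN : 2 ≤ N) : Continuous (dyadicLim f) :=
  (hρ.equicontinuous_of_hasLocalModulus (by positivity : (0 : ℝ) < (1 / 2) ^ j) fun _ : Unit =>
    h.hasLocalModulus_of_tendsto hρ hs hN le_rfl (h.tendsto_dyadicUp hρ hs)
      (h.tendsto_dyadicDown hρ hs)).continuous ()

variable [MeasurableSpace E] [BorelSpace E] [SecondCountableTopology E]
  {Ω : Type*} [MeasurableSpace Ω] {P : Measure Ω} {W : I → Ω → E} {κ K' : ℝ}

theorem measurableSet_exists_hasDyadicModulus (hW : ∀ u, Measurable (W u)) (ρ : ℝ → ℝ) (s : ℝ)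
    (N : ℕ) : MeasurableSet {ω | ∃ j, HasDyadicModulus ρ s N j fun u => W u ω} := by
  simp only [HasDyadicModulus, Set.ofPred_exists, Set.ofPred_forall]
  exact .iUnion fun j => .iInter fun m => .iInter fun _ => .iInter fun a => .iInter fun _ =>
    .iInter fun d => .iInter fun _ => measurableSet_le ((hW _).dist (hW _)) measurable_const

theorem HasIncrTail.exists_modification [CompleteSpace E] (h : HasIncrTail P W ρ s κ K')
    (hW : ∀ u, Measurable (W u)) (hρ : IsPowerGauge ρ p K) (hs : 0 ≤ s) (hκ : 1 < κ)
    (hK' : 0 ≤ K') : ∃ V : I → Ω → E,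
      (∀ u, Measurable (V u)) ∧ (∀ ω, Continuous fun u => V u ω) ∧ ∀ u, V u =ᵐ[P] W u := by
  classical
  set G := {ω | ∃ j, HasDyadicModulus ρ s 2 j fun u => W u ω}
  have hG : MeasurableSet G := measurableSet_exists_hasDyadicModulus hW ρ s 2
  have hlim {ω} (hω : ω ∈ G) (u : I) :
      Tendsto (fun m => W (dyadicDown m u) ω) atTop (𝓝 (dyadicLim (fun u => W u ω) u)) :=
    hω.elim fun _ hj => hj.tendsto_dyadicDown hρ hs u
  refine ⟨fun u ω => if ω ∈ G then dyadicLim (fun u => W u ω) u else W 0 ω, fun u => ?_,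
    fun ω => ?_, fun u => ?_⟩
  · refine measurable_of_tendsto_metrizable
      (f := fun m ω => if ω ∈ G then W (dyadicDown m u) ω else W 0 ω)
      (fun m => (hW _).ite hG (hW 0)) (tendsto_pi_nhds.2 fun ω => ?_)
    by_cases hω : ω ∈ G
    · simpa only [hω, if_true] using hlim hω u
    · simpa only [hω, if_false] using tendsto_const_nhds
  · by_cases hω : ω ∈ G
    · simpa only [hω, if_true] using hω.elim fun _ hj => hj.continuous_dyadicLim hρ hs le_rfl
    · simpa only [hω, if_false] using continuous_const
  · filter_upwards [h.ae_exists_hasDyadicModulus hκ hK' 2,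
      h.ae_tendsto_dyadicDown hρ hs (zero_lt_one.trans hκ) hK' u] with ω hω hconv
    exact (if_pos hω).trans (tendsto_nhds_unique (hlim hω u) hconv)

end Modification

section ConvergenceInDistribution

variable {ι : Type*} {l : Filter ι} {Ω : ι → Type*} [∀ i, MeasurableSpace (Ω i)]
  {P : ∀ i, Measure (Ω i)} [∀ i, IsProbabilityMeasure (P i)] {Ω' : Type*} [MeasurableSpace Ω']
  {P' : Measure Ω'} [IsProbabilityMeasure P'] {E : Type*} [MeasurableSpace E]

theorem le_liminf_measure_preimage_of_tendstoInDistribution [TopologicalSpace E]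
    [OpensMeasurableSpace E] [HasOuterApproxClosed E] {X : ∀ i, Ω i → E} {X' : Ω' → E}
    (h : TendstoInDistribution X l X' P P') {G : Set E} (hG : IsOpen G) :
    P' (X' ⁻¹' G) ≤ liminf (fun i => P i (X i ⁻¹' G)) l := by
  have hle := ProbabilityMeasure.le_liminf_measure_open_of_tendsto h.tendsto hG
  simpa only [ProbabilityMeasure.coe_mk, Measure.map_apply_of_aemeasurable h.aemeasurable_limit
    hG.measurableSet, Measure.map_apply_of_aemeasurable (h.forall_aemeasurable _)
    hG.measurableSet] using hle

theorem limsup_measure_preimage_le_of_tendstoInDistribution [TopologicalSpace E]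
    [OpensMeasurableSpace E] [HasOuterApproxClosed E] {X : ∀ i, Ω i → E} {X' : Ω' → E}
    (h : TendstoInDistribution X l X' P P') {F : Set E} (hF : IsClosed F) :
    limsup (fun i => P i (X i ⁻¹' F)) l ≤ P' (X' ⁻¹' F) := by
  have hle := ProbabilityMeasure.limsup_measure_closed_le_of_tendsto h.tendsto hF
  simpa only [ProbabilityMeasure.coe_mk, Measure.map_apply_of_aemeasurable h.aemeasurable_limit
    hF.measurableSet, Measure.map_apply_of_aemeasurable (h.forall_aemeasurable _)
    hF.measurableSet] using hle

theorem tendstoInDistribution_of_limsup_measure_preimage_le [l.IsCountablyGenerated]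
    [TopologicalSpace E] [OpensMeasurableSpace E] {X : ∀ i, Ω i → E} {X' : Ω' → E}
    (hX : ∀ i, AEMeasurable (X i) (P i)) (hX' : AEMeasurable X' P')
    (h : ∀ F, IsClosed F → limsup (fun i => P i (X i ⁻¹' F)) l ≤ P' (X' ⁻¹' F)) :
    TendstoInDistribution X l X' P P' where
  forall_aemeasurable := hX
  aemeasurable_limit := hX'
  tendsto := by
    have := fun i => Measure.isProbabilityMeasure_map (hX i)
    have := Measure.isProbabilityMeasure_map hX'
    refine tendsto_of_forall_isClosed_limsup_le' fun F hF => ?_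
    simpa only [ProbabilityMeasure.coe_mk, Measure.map_apply_of_aemeasurable hX' hF.measurableSet,
      Measure.map_apply_of_aemeasurable (hX _) hF.measurableSet] using h F hF

theorem tendstoInDistribution_of_isInducing [l.IsCountablyGenerated] [TopologicalSpace E]
    [OpensMeasurableSpace E] {E' : Type*} [TopologicalSpace E'] [HasOuterApproxClosed E']
    [MeasurableSpace E'] [OpensMeasurableSpace E'] {Φ : E → E'} (hΦ : IsInducing Φ)
    {X : ∀ i, Ω i → E} {X' : Ω' → E} (hX : ∀ i, AEMeasurable (X i) (P i))
    (hX' : AEMeasurable X' P')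
    (h : TendstoInDistribution (fun i ω => Φ (X i ω)) l (fun ω => Φ (X' ω)) P P') :
    TendstoInDistribution X l X' P P' := by
  refine tendstoInDistribution_of_limsup_measure_preimage_le hX hX' fun F hF => ?_
  obtain ⟨F', hF', rfl⟩ := hΦ.isClosed_iff.1 hF
  exact limsup_measure_preimage_le_of_tendstoInDistribution h hF'

theorem measurable_of_isInducing [TopologicalSpace E] [BorelSpace E] {E' : Type*}
    [TopologicalSpace E'] [MeasurableSpace E'] [OpensMeasurableSpace E'] {Φ : E → E'}
    (hΦ : IsInducing Φ) {X : Ω' → E} (hX : Measurable fun ω => Φ (X ω)) : Measurable X := by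
  refine measurable_of_isOpen fun U hU => ?_
  obtain ⟨U', hU', rfl⟩ := hΦ.isOpen_iff.1 hU
  exact hX hU'.measurableSet

theorem measure_preimage_le_measure_preimage_cthickening_add {E : Type*} [PseudoMetricSpace E]
    (μ : Measure Ω') (X Z : Ω' → E) (ε : ℝ) (F : Set E) :
    μ (X ⁻¹' F) ≤ μ (Z ⁻¹' Metric.cthickening ε F) + μ {ω | ε < dist (X ω) (Z ω)} := by
  refine (measure_mono fun ω hω => ?_).trans (measure_union_le _ _)
  rcases lt_or_ge ε (dist (X ω) (Z ω)) with hd | hd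
  · exact Or.inr hd
  · exact Or.inl (Metric.mem_cthickening_of_dist_le _ _ _ _ hω (by rwa [dist_comm]))

theorem tendstoInDistribution_of_forall_approx [l.NeBot] [l.IsCountablyGenerated]
    [PseudoMetricSpace E] [BorelSpace E] {X : ∀ i, Ω i → E} {X' : Ω' → E}
    (hX : ∀ i, AEMeasurable (X i) (P i)) (hX' : AEMeasurable X' P')
    (h : ∀ ε : ℝ, 0 < ε → ∃ (Z : ∀ i, Ω i → E) (Z' : Ω' → E),
      TendstoInDistribution Z l Z' P P' ∧
      (∀ i, P i {ω | ε < dist (X i ω) (Z i ω)} ≤ ENNReal.ofReal ε) ∧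
      P' {ω | ε < dist (X' ω) (Z' ω)} ≤ ENNReal.ofReal ε) :
    TendstoInDistribution X l X' P P' := by
  refine tendstoInDistribution_of_limsup_measure_preimage_le hX hX' fun F hF => ?_
  have := Measure.isProbabilityMeasure_map hX'
  have hthick : Tendsto (fun ε : ℝ => P' (X' ⁻¹' Metric.cthickening (ε + ε) F)) (𝓝[>] 0)
      (𝓝 (P' (X' ⁻¹' F))) := by
    have hadd : Tendsto (fun ε : ℝ => ε + ε) (𝓝[>] 0) (𝓝 0) :=
      ((continuous_id.add continuous_id).tendsto' 0 0 (add_zero 0)).mono_left nhdsWithin_le_nhds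
    simpa only [Function.comp_def, Measure.map_apply_of_aemeasurable hX' hF.measurableSet,
      Measure.map_apply_of_aemeasurable hX' Metric.isClosed_cthickening.measurableSet] using
      (tendsto_measure_cthickening_of_isClosed (μ := P'.map X')
        ⟨1, one_pos, measure_ne_top _ _⟩ hF).comp hadd
  have hofReal : Tendsto ENNReal.ofReal (𝓝[>] 0) (𝓝 0) :=
    (ENNReal.continuous_ofReal.tendsto' 0 0 ENNReal.ofReal_zero).mono_left nhdsWithin_le_nhds
  have hlim := (hthick.add hofReal).add hofReal
  rw [add_zero, add_zero] at hlim
  refine ge_of_tendsto hlim ?_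
  filter_upwards [self_mem_nhdsWithin] with ε hε
  obtain ⟨Z, Z', hZ, hXZ, hXZ'⟩ := h ε hε
  calc limsup (fun i => P i (X i ⁻¹' F)) l
      ≤ limsup (fun i => P i (Z i ⁻¹' Metric.cthickening ε F) + ENNReal.ofReal ε) l :=
        limsup_le_limsup <| .of_forall fun i =>
          (measure_preimage_le_measure_preimage_cthickening_add _ _ (Z i) ε F).trans <|
            add_le_add_right (hXZ i) _
    _ = limsup (fun i => P i (Z i ⁻¹' Metric.cthickening ε F)) l + ENNReal.ofReal ε :=
        limsup_add_const _ _ _ (by isBoundedDefault) (by isBoundedDefault)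
    _ ≤ P' (Z' ⁻¹' Metric.cthickening ε F) + ENNReal.ofReal ε := by
        gcongr
        exact limsup_measure_preimage_le_of_tendstoInDistribution hZ Metric.isClosed_cthickening
    _ ≤ P' (X' ⁻¹' Metric.cthickening (ε + ε) F) + ENNReal.ofReal ε + ENNReal.ofReal ε := by
        gcongr
        refine (measure_preimage_le_measure_preimage_cthickening_add _ _ X' ε _).trans ?_
        simp only [dist_comm (Z' _)]
        gcongr
        exact Metric.cthickening_cthickening_subset hε.le hε.le F

end ConvergenceInDistribution

section ContinuousPaths

variable {K E : Type*} [PseudoMetricSpace K]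

/-- The increments of `f` over distances less than `δ` are at most `ε`. -/
def OscillationLE [PseudoMetricSpace E] (δ ε : ℝ) (f : K → E) : Prop :=
  ∀ x y, dist x y < δ → dist (f x) (f y) ≤ ε

/-- Equicontinuity in probability: the modulus of continuity of the paths of `Y i` tends to `0` in
probability, uniformly in `i`. -/
def StochasticallyEquicontinuous [PseudoMetricSpace E] {ι : Type*} {Ω : ι → Type*}
    [∀ i, MeasurableSpace (Ω i)] (P : ∀ i, Measure (Ω i)) (Y : ∀ i, Ω i → K → E) : Prop :=
  ∀ ε : ℝ, 0 < ε → ∃ δ, 0 < δ ∧ ∀ i, P i {ω | ¬ OscillationLE δ ε (Y i ω)} ≤ ENNReal.ofReal ε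

theorem StochasticallyEquicontinuous.congr [PseudoMetricSpace E] {ι : Type*} {Ω : ι → Type*}
    [∀ i, MeasurableSpace (Ω i)] {P : ∀ i, Measure (Ω i)} {Y Z : ∀ i, Ω i → K → E}
    (h : StochasticallyEquicontinuous P Y) (hYZ : ∀ i, Y i =ᵐ[P i] Z i) :
    StochasticallyEquicontinuous P Z := fun ε hε => by
  obtain ⟨δ, hδ, hle⟩ := h ε hε
  refine ⟨δ, hδ, fun i => (measure_mono_ae ?_).trans (hle i)⟩
  filter_upwards [hYZ i] with ω hω hosc
  exact fun hY => hosc (hω ▸ hY)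

theorem OscillationLE.anti [PseudoMetricSpace E] {δ δ' ε : ℝ} {f : K → E}
    (h : OscillationLE δ ε f) (hδ : δ' ≤ δ) : OscillationLE δ' ε f :=
  fun x y hxy => h x y (hxy.trans_le hδ)

theorem isClosed_setOf_oscillationLE [PseudoMetricSpace E] (δ ε : ℝ) :
    IsClosed {f : C(K, E) | OscillationLE δ ε f} := by
  simp only [OscillationLE, Set.ofPred_forall]
  exact isClosed_iInter fun x => isClosed_iInter fun y => isClosed_iInter fun _ =>
    isClosed_le (by fun_prop) continuous_const

variable [CompactSpace K] {Ω' : Type*} [MeasurableSpace Ω']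

theorem exists_oscillationLE [PseudoMetricSpace E] (f : C(K, E)) {ε : ℝ} (hε : 0 < ε) :
    ∃ δ, 0 < δ ∧ OscillationLE δ ε f := by
  obtain ⟨δ, hδ, h⟩ := Metric.uniformContinuous_iff.1
    (CompactSpace.uniformContinuous_of_continuous f.continuous) ε hε
  exact ⟨δ, hδ, fun x y hxy => (h hxy).le⟩

theorem UniformLocalModulus.stochasticallyEquicontinuous [PseudoMetricSpace E] {ι : Type*}
    {Ω : ι → Type*} [∀ i, MeasurableSpace (Ω i)] {P : ∀ i, Measure (Ω i)} {E' : Type*}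
    [PseudoMetricSpace E'] {W : ∀ i, I → Ω i → E'} {ρ : ℝ → ℝ} {t : ℝ}
    (h : UniformLocalModulus P W ρ t) {F : (I → E') → K → E}
    (hF : ∀ r, 0 < r → Equicontinuous fun f : {f : I → E' // HasLocalModulus ρ t r f} => F f.1) :
    StochasticallyEquicontinuous P fun i ω => F fun u => W i u ω := by
  intro ε hε
  obtain ⟨r, hr0, hr⟩ := h.exists_measure_le (ENNReal.ofReal_pos.2 hε)
  obtain ⟨δ, hδ, hosc⟩ := Metric.uniformEquicontinuous_iff.1
    (CompactSpace.uniformEquicontinuous_of_equicontinuous (hF r hr0)) ε hε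
  refine ⟨δ, hδ, fun i => (measure_mono fun ω hω => ?_).trans (hr i)⟩
  exact fun hmod => hω fun x y hxy => (hosc x y hxy ⟨_, hmod⟩).le

theorem exists_measure_not_oscillationLE_le [PseudoMetricSpace E] [MeasurableSpace C(K, E)]
    [BorelSpace C(K, E)] {P' : Measure Ω'} [IsFiniteMeasure P'] {X : Ω' → C(K, E)}
    (hX : Measurable X) {ε : ℝ} (hε : 0 < ε) {η : ℝ≥0∞} (hη : 0 < η) :
    ∃ δ, 0 < δ ∧ P' {ω | ¬ OscillationLE δ ε (X ω)} ≤ η := by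
  set A : ℕ → Set Ω' := fun k => {ω | ¬ OscillationLE (1 / ((k : ℝ) + 1)) ε (X ω)}
  have hA : Antitone A := fun k m hkm ω hω =>
    fun h => hω (h.anti (Nat.one_div_le_one_div hkm))
  have hAmeas (k : ℕ) : MeasurableSet (A k) :=
    (hX (isClosed_setOf_oscillationLE _ _).measurableSet).compl
  have hempty : ⋂ k, A k = ∅ := by
    refine Set.eq_empty_of_forall_notMem fun ω hω => ?_
    obtain ⟨δ, hδ, hosc⟩ := exists_oscillationLE (X ω) hε
    obtain ⟨k, hk⟩ := exists_nat_one_div_lt hδ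
    exact Set.mem_iInter.1 hω k (hosc.anti hk.le)
  have hlim := tendsto_measure_iInter_atTop (μ := P') (fun k => (hAmeas k).nullMeasurableSet) hA
    ⟨0, measure_ne_top _ _⟩
  rw [hempty, measure_empty] at hlim
  obtain ⟨k, hk⟩ := (hlim.eventually_le_const hη).exists
  exact ⟨1 / ((k : ℝ) + 1), by positivity, hk⟩

theorem exists_continuous_interpolation [NormedAddCommGroup E] [NormedSpace ℝ E] (K : Type*)
    [PseudoMetricSpace K] [CompactSpace K] {δ : ℝ} (hδ : 0 < δ) :
    ∃ (S : Finset K) (L : (S → E) → C(K, E)), Continuous L ∧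
      ∀ (f : C(K, E)) (ε : ℝ), 0 ≤ ε → OscillationLE δ ε f → dist f (L fun k => f k) ≤ ε := by
  obtain ⟨S, -, hS⟩ := isCompact_univ.elim_nhds_subcover (fun x : K => Metric.ball x δ)
    fun x _ => Metric.ball_mem_nhds x hδ
  obtain ⟨φ, hφ⟩ := PartitionOfUnity.exists_isSubordinate isClosed_univ
    (fun i : S => Metric.ball (i : K) δ) (fun _ => Metric.isOpen_ball)
    (by rwa [Set.iUnion_subtype])
  refine ⟨S, fun w => ⟨fun x => ∑ i, φ i x • w i, by fun_prop⟩,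
    ContinuousMap.continuous_of_continuous_uncurry _
      (by fun_prop : Continuous fun z : (S → E) × K => ∑ i, φ i z.2 • z.1 i),
    fun f ε hε hf => ?_⟩
  refine (ContinuousMap.dist_le hε).2 fun x => ?_
  have hmem : ∑ᶠ i, φ i x • f i ∈ Metric.closedBall (f x) ε :=
    φ.finsum_smul_mem_convex (g := fun i _ => f i) (Set.mem_univ x)
      (fun i hi => Metric.mem_closedBall'.2 (hf x i (hφ i (subset_tsupport _ hi))))
      (convex_closedBall _ _)
  rw [finsum_eq_sum_of_fintype] at hmem
  exact Metric.mem_closedBall'.1 hmem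

variable [NormedAddCommGroup E] [NormedSpace ℝ E] [MeasurableSpace E] [BorelSpace E]
  [SecondCountableTopology E] [MeasurableSpace C(K, E)] [BorelSpace C(K, E)]

theorem measurable_continuousMap_of_eval {X : Ω' → C(K, E)}
    (hX : ∀ x, Measurable fun ω => X ω x) : Measurable X := by
  have hpos (k : ℕ) : (0 : ℝ) < 1 / (k + 1) := by positivity
  choose S L hL hdist using fun k => exists_continuous_interpolation (E := E) K (hpos k)
  refine measurable_of_tendsto_metrizable (f := fun k ω => L k fun i : S k => X ω i)
    (fun k => (hL k).measurable.comp (measurable_pi_lambda _ fun i => hX i))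
    (tendsto_pi_nhds.2 fun ω => Metric.tendsto_nhds.2 fun ε hε => ?_)
  obtain ⟨δ, hδ, hosc⟩ := exists_oscillationLE (X ω) (half_pos hε)
  filter_upwards [tendsto_one_div_add_atTop_nhds_zero_nat.eventually_le_const hδ] with k hk
  rw [dist_comm]
  exact (hdist k _ _ (half_pos hε).le (hosc.anti hk)).trans_lt (half_lt_self hε)

variable {ι : Type*} {l : Filter ι} [l.NeBot] [l.IsCountablyGenerated] {Ω : ι → Type*}
  [∀ i, MeasurableSpace (Ω i)] {P : ∀ i, Measure (Ω i)} [∀ i, IsProbabilityMeasure (P i)]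
  {P' : Measure Ω'} [IsProbabilityMeasure P']

theorem StochasticallyEquicontinuous.tendstoInDistribution {X : ∀ i, Ω i → C(K, E)}
    {X' : Ω' → C(K, E)} (hequi : StochasticallyEquicontinuous P fun i ω => X i ω)
    (hX : ∀ i, Measurable (X i)) (hX' : Measurable X')
    (hfidi : ∀ S : Finset K, TendstoInDistribution (fun i ω (k : S) => X i ω k) l
      (fun ω k => X' ω k) P P') :
    TendstoInDistribution X l X' P P' := by
  refine tendstoInDistribution_of_forall_approx (fun i => (hX i).aemeasurable) hX'.aemeasurable
    fun ε hε => ?_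
  obtain ⟨δ, hδ, hP⟩ := hequi ε hε
  obtain ⟨δ', hδ', hP'⟩ :=
    exists_measure_not_oscillationLE_le (P' := P') hX' hε (ENNReal.ofReal_pos.2 hε)
  obtain ⟨S, L, hL, hdist⟩ := exists_continuous_interpolation (E := E) K (lt_min hδ hδ')
  have hsub (f : C(K, E)) {η : ℝ} (hη : min δ δ' ≤ η) (hf : ε < dist f (L fun k => f k)) :
      ¬ OscillationLE η ε f :=
    fun hosc => hf.not_ge (hdist f ε hε.le (hosc.anti hη))
  exact ⟨fun i ω => L fun k => X i ω k, fun ω => L fun k => X' ω k, (hfidi S).continuous_comp hL,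
    fun i => (measure_mono fun ω => hsub _ (min_le_left _ _)).trans (hP i),
    (measure_mono fun ω => hsub _ (min_le_right _ _)).trans hP'⟩

end ContinuousPaths

section HolderZero

variable {ρ : ℝ → ℝ}

/-- The function on the square that encodes the value at `0` and all the weighted increments of `f`.
On the diagonal its value is `f 0`, since `x / 0 = 0`. -/
noncomputable def holderLift (ρ : ℝ → ℝ) (f : I → ℝ) (k : I × I) : ℝ :=
  f 0 + (f k.1 - f k.2) / ρ (dist k.1 k.2)

theorem holderLift_diag (ρ : ℝ → ℝ) (f : I → ℝ) (u : I) : holderLift ρ f (u, u) = f 0 := by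
  simp [holderLift]

theorem IsModulus.dist_holderLift_zero_le (hρ : IsModulus ρ) {f : I → ℝ} {t : ℝ} (ht : 0 ≤ t)
    {k : I × I} (hk : dist (f k.1) (f k.2) ≤ t * ρ (dist k.1 k.2)) :
    dist (f 0) (holderLift ρ f k) ≤ t := by
  have hk0 := hρ.nonneg (dist_mem_Icc k.1 k.2)
  rw [holderLift, dist_self_add_right, Real.norm_eq_abs, abs_div, abs_of_nonneg hk0]
  exact div_le_of_le_mul₀ hk0 ht hk

theorem IsModulus.dist_holderLift_le (hρ : IsModulus ρ) (f : I → ℝ) (x y : I × I) :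
    dist (holderLift ρ f x) (holderLift ρ f y) ≤
      (dist (f x.1) (f y.1) + dist (f x.2) (f y.2)) / ρ (dist y.1 y.2) +
        dist (f x.1) (f x.2) * dist (ρ (dist x.1 x.2))⁻¹ (ρ (dist y.1 y.2))⁻¹ := by
  have hy := hρ.nonneg (dist_mem_Icc y.1 y.2)
  have hsplit : holderLift ρ f x - holderLift ρ f y =
      ((f x.1 - f y.1) - (f x.2 - f y.2)) / ρ (dist y.1 y.2) +
        (f x.1 - f x.2) * ((ρ (dist x.1 x.2))⁻¹ - (ρ (dist y.1 y.2))⁻¹) := by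
    simp only [holderLift]
    ring
  simp only [Real.dist_eq (holderLift ρ f x), Real.dist_eq (f _), Real.dist_eq (ρ _)⁻¹, hsplit]
  refine (abs_add_le _ _).trans (add_le_add ?_ (abs_mul _ _).le)
  rw [abs_div, abs_of_nonneg hy]
  exact div_le_div_of_nonneg_right (abs_sub _ _) hy

variable {ι : Type*} {F : ι → I → ℝ}

theorem equicontinuousAt_holderLift_diag (hρ : IsModulus ρ)
    (hF : ∀ ε : ℝ, 0 < ε → ∃ r, 0 < r ∧ ∀ i, HasLocalModulus ρ ε r (F i)) (u : I) :
    EquicontinuousAt (fun i => holderLift ρ (F i)) (u, u) := by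
  refine Metric.equicontinuousAt_iff_right.2 fun ε hε => ?_
  obtain ⟨r, hr, hmod⟩ := hF (ε / 2) (half_pos hε)
  have hdist : Tendsto (fun x : I × I => dist x.1 x.2) (𝓝 (u, u)) (𝓝 0) :=
    continuous_dist.tendsto' _ _ (dist_self u)
  filter_upwards [hdist.eventually_le_const hr] with x hx i
  rw [holderLift_diag]
  exact (hρ.dist_holderLift_zero_le (half_pos hε).le (hmod i _ _ hx)).trans_lt (half_lt_self hε)

theorem equicontinuousAt_holderLift_of_ne (hρ : IsModulus ρ) {r : ℝ} (hr : 0 < r)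
    (hF : ∀ i, HasLocalModulus ρ 1 r (F i)) {k : I × I} (hk : k.1 ≠ k.2) :
    EquicontinuousAt (fun i => holderLift ρ (F i)) k := by
  have hpos : 0 < ρ (dist k.1 k.2) := hρ.pos _ ⟨dist_pos.2 hk, (dist_mem_Icc _ _).2⟩
  have hinv : ContinuousAt (fun x : I × I => (ρ (dist x.1 x.2))⁻¹) k :=
    (hρ.continuous_dist continuous_fst continuous_snd).continuousAt.inv₀ hpos.ne'
  have hfst := hρ.continuous_dist (continuous_const (y := k.1)) (continuous_fst (Y := I))
  have hsnd := hρ.continuous_dist (continuous_const (y := k.2)) (continuous_snd (X := I))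
  have hlim : Tendsto (fun x : I × I => (ρ (dist k.1 x.1) + ρ (dist k.2 x.2)) / ρ (dist x.1 x.2) +
      ⌈1 / r⌉₊ * (1 * ρ 1) * dist (ρ (dist k.1 k.2))⁻¹ (ρ (dist x.1 x.2))⁻¹) (𝓝 k) (𝓝 0) := by
    have hsum := ((hfst.add hsnd).continuousAt (x := k)).tendsto.mul hinv.tendsto
    have hdist := (tendsto_const_nhds (x := (ρ (dist k.1 k.2))⁻¹)).dist hinv.tendsto
    simpa only [Pi.add_apply, dist_self, hρ.map_zero, add_zero, zero_mul, mul_zero,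
      div_eq_mul_inv (ρ _ + ρ _)] using hsum.add (hdist.const_mul (⌈1 / r⌉₊ * (1 * ρ 1)))
  refine Metric.equicontinuousAt_of_continuity_modulus _ hlim _ ?_
  filter_upwards [(continuous_const.dist continuous_fst).tendsto' k _ (dist_self k.1)
    |>.eventually_le_const hr, (continuous_const.dist continuous_snd).tendsto' k _ (dist_self k.2)
    |>.eventually_le_const hr] with x hx1 hx2 i
  have hx := hρ.nonneg (dist_mem_Icc x.1 x.2)
  refine (hρ.dist_holderLift_le (F i) k x).trans (add_le_add ?_ ?_)
  · simpa only [one_mul] using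
      div_le_div_of_nonneg_right (add_le_add (hF i _ _ hx1) (hF i _ _ hx2)) hx
  · exact mul_le_mul_of_nonneg_right ((hF i).dist_le hρ.monotoneOn zero_le_one hr _ _) dist_nonneg

theorem equicontinuous_holderLift (hρ : IsModulus ρ)
    (hF : ∀ ε : ℝ, 0 < ε → ∃ r, 0 < r ∧ ∀ i, HasLocalModulus ρ ε r (F i)) :
    Equicontinuous fun i => holderLift ρ (F i) := by
  rintro ⟨u, v⟩
  rcases eq_or_ne u v with rfl | huv
  · exact equicontinuousAt_holderLift_diag hρ hF u
  · obtain ⟨r, hr, hmod⟩ := hF 1 one_pos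
    exact equicontinuousAt_holderLift_of_ne hρ hr hmod huv

theorem continuous_holderLift (hρ : IsModulus ρ) {f : I → ℝ}
    (hf : Tendsto (fun δ => localHolder ρ δ f) (𝓝[>] 0) (𝓝 0)) : Continuous (holderLift ρ f) :=
  (equicontinuous_holderLift (F := fun _ : Unit => f) hρ fun ε hε =>
    (hρ.tendsto_localHolder_zero_iff.1 hf ε hε).imp fun _ ⟨hr, hmod⟩ => ⟨hr, fun _ => hmod⟩)
    |>.continuous ()

/-- The additive embedding `holderLift ρ` of `C^ρ_0` into the continuous functions on the square,
which reduces weak convergence in `C^ρ_0` to weak convergence in a space of continuous functions. -/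
noncomputable def holderZeroLift (hρ : IsModulus ρ) : holderZero ρ →+ C(I × I, ℝ) where
  toFun f := ⟨holderLift ρ f.1.toC, continuous_holderLift hρ f.2⟩
  map_zero' := by
    ext k
    change (0 : ℝ) + (0 - 0) / _ = 0
    simp
  map_add' f g := by
    ext k
    change (f.1.toC 0 + g.1.toC 0) + ((f.1.toC k.1 + g.1.toC k.1) - (f.1.toC k.2 + g.1.toC k.2)) / _
      = holderLift ρ f.1.toC k + holderLift ρ g.1.toC k
    simp only [holderLift]
    ring

theorem holderZeroLift_apply (hρ : IsModulus ρ) (f : holderZero ρ) (k : I × I) :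
    holderZeroLift hρ f k = holderLift ρ f.1.toC k := rfl

theorem norm_holderZero (f : holderZero ρ) :
    ‖f‖ = ‖f.1.toC‖ + (holderSeminorm ρ f.1.toC).toReal := rfl

theorem IsModulus.dist_le_toReal_holderSeminorm_mul (hρ : IsModulus ρ) {f : I → ℝ}
    (hf : holderSeminorm ρ f ≠ ∞) (u v : I) :
    dist (f u) (f v) ≤ (holderSeminorm ρ f).toReal * ρ (dist u v) :=
  (holderSeminorm_le_ofReal_iff (fun _ => hρ.nonneg) ENNReal.toReal_nonneg).1
    (ENNReal.ofReal_toReal hf).ge u v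

theorem norm_holderZeroLift_le (hρ : IsModulus ρ) (f : holderZero ρ) :
    ‖holderZeroLift hρ f‖ ≤ ‖f‖ := by
  rw [norm_holderZero]
  refine (ContinuousMap.norm_le _ (by positivity)).2 fun k => ?_
  rw [holderZeroLift_apply]
  have hdist := hρ.dist_holderLift_zero_le ENNReal.toReal_nonneg
    (hρ.dist_le_toReal_holderSeminorm_mul f.1.2 k.1 k.2)
  rw [dist_comm, dist_eq_norm] at hdist
  exact (norm_le_norm_add_norm_sub' _ _).trans
    (add_le_add (f.1.toC.norm_coe_le_norm 0) hdist)

theorem dist_le_norm_holderZeroLift_mul (hρ : IsModulus ρ) (f : holderZero ρ) (u v : I) :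
    dist (f.1.toC u) (f.1.toC v) ≤ 2 * ‖holderZeroLift hρ f‖ * ρ (dist u v) := by
  rcases eq_or_ne u v with rfl | huv
  · simp [hρ.map_zero]
  have hpos : 0 < ρ (dist u v) := hρ.pos _ ⟨dist_pos.2 huv, (dist_mem_Icc u v).2⟩
  rw [← div_le_iff₀ hpos, Real.dist_eq, ← abs_of_pos hpos, ← abs_div]
  have hincr : (f.1.toC u - f.1.toC v) / ρ (dist u v) =
      holderZeroLift hρ f (u, v) - holderZeroLift hρ f (0, 0) := by
    rw [holderZeroLift_apply, holderZeroLift_apply, holderLift_diag, holderLift,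
      add_sub_cancel_left]
  rw [hincr, two_mul]
  have hnorm := (holderZeroLift hρ f).norm_coe_le_norm
  exact (norm_sub_le _ _).trans (add_le_add (hnorm _) (hnorm _))

theorem norm_le_mul_norm_holderZeroLift (hρ : IsModulus ρ) (f : holderZero ρ) :
    ‖f‖ ≤ (3 + 2 * ρ 1) * ‖holderZeroLift hρ f‖ := by
  have hρ1 : 0 ≤ ρ 1 := hρ.nonneg (by simp)
  have hincr := dist_le_norm_holderZeroLift_mul hρ f
  have hzero : ‖f.1.toC 0‖ ≤ ‖holderZeroLift hρ f‖ := by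
    have hnorm := (holderZeroLift hρ f).norm_coe_le_norm (0, 0)
    rwa [holderZeroLift_apply, holderLift_diag] at hnorm
  have hsup : ‖f.1.toC‖ ≤ ‖holderZeroLift hρ f‖ + 2 * ‖holderZeroLift hρ f‖ * ρ 1 := by
    refine (ContinuousMap.norm_le _ (by positivity)).2 fun u => ?_
    have hu := dist_mem_Icc u 0
    refine (norm_le_norm_add_norm_sub' _ _).trans (add_le_add hzero ((hincr u 0).trans ?_))
    exact mul_le_mul_of_nonneg_left (hρ.monotoneOn hu (by simp) hu.2) (by positivity)
  have hsemi : (holderSeminorm ρ f.1.toC).toReal ≤ 2 * ‖holderZeroLift hρ f‖ :=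
    ENNReal.toReal_le_of_le_ofReal (by positivity)
      ((holderSeminorm_le_ofReal_iff (fun _ => hρ.nonneg) (by positivity)).2 hincr)
  rw [norm_holderZero]
  linarith

theorem isInducing_holderZeroLift (hρ : IsModulus ρ) : IsInducing (holderZeroLift hρ) := by
  have hlip := AddMonoidHomClass.lipschitz_of_bound (holderZeroLift hρ) 1 fun f => by
    rw [one_mul]
    exact norm_holderZeroLift_le hρ f
  have hanti : AntilipschitzWith (3 + 2 * ρ 1).toNNReal (holderZeroLift hρ) :=
    AddMonoidHomClass.antilipschitz_of_bound (holderZeroLift hρ) fun f => by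
      rw [Real.coe_toNNReal _ (by linarith [hρ.nonneg (x := 1) (by simp)])]
      exact norm_le_mul_norm_holderZeroLift hρ f
  exact (hanti.isUniformInducing hlip.uniformContinuous).isInducing

theorem IsModulus.exists_holderZero_toC_eq (hρ : IsModulus ρ) {f : I → ℝ} (hf : Continuous f)
    (hmod : ∀ ε : ℝ, 0 < ε → ∃ r, 0 < r ∧ HasLocalModulus ρ ε r f) :
    ∃ g : holderZero ρ, ∀ u, g.1.toC u = f u := by
  obtain ⟨r, hr, hr1⟩ := hmod 1 one_pos
  obtain ⟨M, hM⟩ := hρ.exists_holderSeminorm_le zero_le_one hr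
  exact ⟨⟨(⟨⟨f, hf⟩, ne_top_of_le_ne_top ENNReal.ofReal_ne_top (hM f hr1)⟩ : holderSubmodule ρ),
    hρ.tendsto_localHolder_zero_iff.2 hmod⟩, fun _ => rfl⟩

theorem IsContinuousProcess.exists_measurable_holderZero {Ω : Type*} [MeasurableSpace Ω]
    {P : Measure Ω} {V : I → Ω → ℝ} (hV : IsContinuousProcess V) (hρ : IsModulus ρ)
    (hmod : ∀ᵐ ω ∂P, ∀ ε : ℝ, 0 < ε → ∃ r, 0 < r ∧ HasLocalModulus ρ ε r fun u => V u ω) :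
    ∃ X : Ω → holderZero ρ, Measurable X ∧ ∀ᵐ ω ∂P, ∀ u, (X ω).1.toC u = V u ω := by
  classical
  obtain ⟨G, hGae, hG, hGmod⟩ := hmod.exists_measurable_mem
  have hpath (ω : Ω) : ∃ g : holderZero ρ, ∀ u, g.1.toC u = if ω ∈ G then V u ω else 0 := by
    by_cases hω : ω ∈ G
    · simpa only [hω, if_true] using hρ.exists_holderZero_toC_eq (hV.continuous ω) (hGmod ω hω)
    · simpa only [hω, if_false] using ⟨0, fun _ => rfl⟩
  choose X hX using hpath
  refine ⟨X, ?_, ?_⟩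
  · borelize C(I × I, ℝ)
    refine measurable_of_isInducing (isInducing_holderZeroLift hρ)
      (measurable_continuousMap_of_eval fun k => ?_)
    have hmeas (u : I) : Measurable fun ω => if ω ∈ G then V u ω else 0 :=
      (hV.measurable u).ite hG measurable_const
    simp only [holderZeroLift_apply, holderLift, hX]
    exact (hmeas 0).add (((hmeas k.1).sub (hmeas k.2)).div_const _)
  · filter_upwards [hGae] with ω hω u
    rw [hX, if_pos hω]

end HolderZero

section UniformBounds

variable {ι : Type*} {Ω : ι → Type*} [∀ i, MeasurableSpace (Ω i)] {P : ∀ i, Measure (Ω i)}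
  {W : ∀ i, I → Ω i → ℝ} {ρ : ℝ → ℝ} {p t C K : ℝ}

/-- The hypothesis (T): beyond the threshold `C`, the tails of the weighted increments are bounded
by a power larger than `1` of the distance, uniformly in the index. -/
def HasIncrTailsBeyond (P : ∀ i, Measure (Ω i)) (W : ∀ i, I → Ω i → ℝ) (ρ : ℝ → ℝ) (C : ℝ) : Prop :=
  ∀ t, C < t → ∃ κ : ℝ, 1 < κ ∧ ∃ K : ℝ, 0 < K ∧ ∀ i, HasIncrTail (P i) (W i) ρ t κ K

theorem hasIncrTail_iff_weightedIncr {Ω : Type*} [MeasurableSpace Ω] {P : Measure Ω}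
    {W : I → Ω → ℝ} {κ : ℝ} (hρ : ∀ x ∈ Set.Icc (0 : ℝ) 1, 0 ≤ ρ x) (ht : 0 ≤ t) :
    HasIncrTail P W ρ t κ K ↔ ∀ u v : I,
      P {ω | ENNReal.ofReal t < weightedIncr ρ (fun x => W x ω) u v} ≤
        ENNReal.ofReal (K * |(u : ℝ) - v| ^ κ) := by
  simp only [HasIncrTail, ← not_le, weightedIncr_le_ofReal_iff (hρ _ (dist_mem_Icc _ _)) ht]
  rfl

theorem HasIncrTailsBeyond.uniformLocalModulus (h : HasIncrTailsBeyond P W ρ C)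
    (hρ : IsPowerGauge ρ p K) (hC : 0 ≤ C) (hCt : C < t)
    (hW : ∀ i ω, Continuous fun u => W i u ω) : UniformLocalModulus P W ρ t := by
  obtain ⟨s, hCs, hst⟩ := exists_between hCt
  obtain ⟨κ, hκ, K', hK', htail⟩ := h s hCs
  exact HasIncrTail.uniformLocalModulus htail hρ (hC.trans hCs.le) hst hκ hK'.le hW

theorem HasIncrTailsBeyond.uniformLocalModulus_of_tendsto_div_one {ρ₀ : ℝ → ℝ}
    (h : HasIncrTailsBeyond P W ρ₀ C) (hρ₀ : IsPowerGauge ρ₀ p K) (hC : 0 ≤ C)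
    (hW : ∀ i ω, Continuous fun u => W i u ω) (hρ : IsModulus ρ)
    (hratio : Tendsto (fun h => ρ h / ρ₀ h) (𝓝[>] 0) (𝓝 1)) (hCt : C < t) :
    UniformLocalModulus P W ρ t := by
  obtain ⟨s, hCs, hst⟩ := exists_between hCt
  exact (h.uniformLocalModulus hρ₀ hC hCs hW).change_gauge hρ.map_zero
    (eventually_mul_le_of_tendsto_div_one hρ₀ hratio (hC.trans hCs.le) hst)

theorem UniformLocalModulus.tendsto_iSup_measure_lt_localHolder (h : UniformLocalModulus P W ρ t)
    (hρ : ∀ x ∈ Set.Icc (0 : ℝ) 1, 0 ≤ ρ x) (ht : 0 ≤ t) :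
    Tendsto (fun h => ⨆ i, P i {ω | ENNReal.ofReal t < localHolder ρ h fun u => W i u ω})
      (𝓝[>] 0) (𝓝 0) := by
  simpa only [UniformLocalModulus, ← localHolder_le_ofReal_iff hρ ht, not_le] using h

theorem UniformLocalModulus.exists_measure_lt_holderSeminorm_le (h : UniformLocalModulus P W ρ t)
    (hρ : IsModulus ρ) (ht : 0 ≤ t) {ε : ℝ≥0∞} (hε : 0 < ε) :
    ∃ M : ℝ, ∀ i, P i {ω | ENNReal.ofReal M < holderSeminorm ρ fun u => W i u ω} ≤ ε := by
  obtain ⟨r, hr0, hr⟩ := h.exists_measure_le hε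
  obtain ⟨M, hM⟩ := hρ.exists_holderSeminorm_le ht hr0
  refine ⟨M, fun i => (measure_mono fun ω hω => ?_).trans (hr i)⟩
  exact fun hmod => (hM _ hmod).not_gt hω

theorem UniformLocalModulus.ae_holderSeminorm_ne_top (h : UniformLocalModulus P W ρ t)
    (hρ : IsModulus ρ) (ht : 0 ≤ t) (i : ι) :
    ∀ᵐ ω ∂(P i), holderSeminorm ρ (fun u => W i u ω) ≠ ∞ := by
  filter_upwards [h.ae_exists i] with ω ⟨r, hr, hmod⟩
  obtain ⟨M, hM⟩ := hρ.exists_holderSeminorm_le ht hr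
  exact ne_top_of_le_ne_top ENNReal.ofReal_ne_top (hM _ hmod)

end UniformBounds

section Limits

variable {Ω : ℕ → Type*} [∀ n, MeasurableSpace (Ω n)] {P : ∀ n, Measure (Ω n)}
  [∀ n, IsProbabilityMeasure (P n)] {Ω' : Type*} [MeasurableSpace Ω'] {P' : Measure Ω'}
  [IsProbabilityMeasure P'] {W : ∀ n, I → Ω n → ℝ} {V W' : I → Ω' → ℝ} {ρ ρ₀ : ℝ → ℝ}
  {p s t κ C K : ℝ}

theorem TendstoFidi.congr (h : TendstoFidi P P' W W') (hV : ∀ u, V u =ᵐ[P'] W' u) :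
    TendstoFidi P P' W V := fun S => by
  refine (h S).congr (fun n => EventuallyEq.rfl) ?_
  filter_upwards [ae_all_iff.2 fun u : S => hV u] with ω hω
  exact funext fun u => (hω u).symm

theorem TendstoFidi.hasIncrTail (h : TendstoFidi P P' W V)
    (hW : ∀ n, HasIncrTail (P n) (W n) ρ s κ K) : HasIncrTail P' V ρ s κ K := fun u v => by
  classical
  have hG : IsOpen {x : ({u, v} : Finset I) → ℝ |
      s * ρ (dist u v) < dist (x ⟨u, by simp⟩) (x ⟨v, by simp⟩)} :=
    isOpen_lt continuous_const (by fun_prop)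
  exact (le_liminf_measure_preimage_of_tendstoInDistribution (h _) hG).trans
    ((liminf_le_liminf (.of_forall fun n => hW n u v)).trans_eq (liminf_const _))

theorem TendstoFidi.hasIncrTailsBeyond (h : TendstoFidi P P' W V)
    (hW : HasIncrTailsBeyond P W ρ C) :
    HasIncrTailsBeyond (fun _ : Unit => P') (fun _ => V) ρ C := fun t ht => by
  obtain ⟨κ, hκ, K, hK, htail⟩ := hW t ht
  exact ⟨κ, hκ, K, hK, fun _ => h.hasIncrTail htail⟩

theorem TendstoFidi.tendstoInDistribution_holderLift (h : TendstoFidi P P' W V) (ρ : ℝ → ℝ)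
    (S : Finset (I × I)) :
    TendstoInDistribution (fun n ω (k : S) => holderLift ρ (fun u => W n u ω) k) atTop
      (fun ω (k : S) => holderLift ρ (fun u => V u ω) k) P P' := by
  classical
  set T : Finset I := insert 0 (S.image Prod.fst ∪ S.image Prod.snd)
  have hfst (k : S) : k.1.1 ∈ T := Finset.mem_insert_of_mem
    (Finset.mem_union_left _ (Finset.mem_image_of_mem _ k.2))
  have hsnd (k : S) : k.1.2 ∈ T := Finset.mem_insert_of_mem
    (Finset.mem_union_right _ (Finset.mem_image_of_mem _ k.2))
  have hg : Continuous fun (w : T → ℝ) (k : S) => w ⟨0, Finset.mem_insert_self _ _⟩ +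
      (w ⟨k.1.1, hfst k⟩ - w ⟨k.1.2, hsnd k⟩) / ρ (dist k.1.1 k.1.2) := by fun_prop
  exact (h T).continuous_comp hg

theorem TendstoFidi.tendstoHolderZero (h : TendstoFidi P P' W V)
    (hW : ∀ n, IsContinuousProcess (W n)) (hV : IsContinuousProcess V) (hρ : IsModulus ρ)
    (hm : MuchLarger ρ ρ₀) (ht : 0 < t) (hWmod : UniformLocalModulus P W ρ₀ t)
    (hVmod : ∀ᵐ ω ∂P', ∃ r, 0 < r ∧ HasLocalModulus ρ₀ t r fun u => V u ω) :
    TendstoHolderZero ρ P P' W V := by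
  have hmod {r : ℝ} (hr : 0 < r) (ε : ℝ) (hε : 0 < ε) : ∃ r', 0 < r' ∧ ∀ f : I → ℝ,
      HasLocalModulus ρ₀ t r f → HasLocalModulus ρ ε r' f :=
    exists_hasLocalModulus_of_eventually_le ℝ hρ.map_zero (hm.eventually_mul_le hρ ht hε) hr
  have hsmall {f : I → ℝ} : (∃ r, 0 < r ∧ HasLocalModulus ρ₀ t r f) →
      ∀ ε : ℝ, 0 < ε → ∃ r, 0 < r ∧ HasLocalModulus ρ ε r f := fun ⟨r, hr, hf⟩ ε hε =>
    (hmod hr ε hε).imp fun r' hr' => ⟨hr'.1, hr'.2 f hf⟩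
  choose X hXm hX using fun n =>
    (hW n).exists_measurable_holderZero hρ ((hWmod.ae_exists n).mono fun ω => hsmall)
  obtain ⟨X', hXm', hX'⟩ := hV.exists_measurable_holderZero hρ (hVmod.mono fun ω => hsmall)
  have hlift (n : ℕ) : (fun ω => holderLift ρ fun u => W n u ω) =ᵐ[P n]
      fun ω => holderZeroLift hρ (X n ω) := by
    filter_upwards [hX n] with ω hω using congrArg (holderLift ρ) (funext hω).symm
  have hlift' : (fun ω => holderLift ρ fun u => V u ω) =ᵐ[P']
      fun ω => holderZeroLift hρ (X' ω) := by
    filter_upwards [hX'] with ω hω using congrArg (holderLift ρ) (funext hω).symm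
  have hequi : StochasticallyEquicontinuous P fun n ω => holderZeroLift hρ (X n ω) :=
    (hWmod.stochasticallyEquicontinuous fun r hr => equicontinuous_holderLift hρ fun ε hε =>
      (hmod hr ε hε).imp fun r' hr' => ⟨hr'.1, fun f => hr'.2 f.1 f.2⟩).congr hlift
  borelize C(I × I, ℝ)
  have hcont := (isInducing_holderZeroLift hρ).continuous.measurable
  refine ⟨X, X', hX, hX', tendstoInDistribution_of_isInducing (isInducing_holderZeroLift hρ)
    (fun n => (hXm n).aemeasurable) hXm'.aemeasurable (hequi.tendstoInDistribution
      (fun n => hcont.comp (hXm n)) (hcont.comp hXm') fun S => ?_)⟩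
  refine (h.tendstoInDistribution_holderLift ρ S).congr (fun n => ?_) ?_
  · filter_upwards [hlift n] with ω hω using funext fun k => congrFun hω k
  · filter_upwards [hlift'] with ω hω using funext fun k => congrFun hω k

/-- The paths of a continuous process as random elements of `C[0,1]`. -/
def IsContinuousProcess.path (hV : IsContinuousProcess V) (ω : Ω') : C(I, ℝ) :=
  ⟨fun u => V u ω, hV.continuous ω⟩

section Path

variable [MeasurableSpace C(I, ℝ)] [BorelSpace C(I, ℝ)]

theorem IsContinuousProcess.measurable_path (hV : IsContinuousProcess V) : Measurable hV.path :=
  measurable_continuousMap_of_eval hV.measurable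

theorem TendstoFidi.tendstoInDistribution_path (h : TendstoFidi P P' W V)
    (hW : ∀ n, IsContinuousProcess (W n)) (hV : IsContinuousProcess V)
    (hρ₀ : IsPowerGauge ρ₀ p K) (hmod : UniformLocalModulus P W ρ₀ t) :
    TendstoInDistribution (fun n => (hW n).path) atTop hV.path P P' :=
  StochasticallyEquicontinuous.tendstoInDistribution
    (hmod.stochasticallyEquicontinuous (F := id) fun _ hr =>
      hρ₀.equicontinuous_of_hasLocalModulus hr fun f => f.2)
    (fun n => (hW n).measurable_path) hV.measurable_path h

end Path

theorem isOpen_setOf_exists_increment_gt (ρ : ℝ → ℝ) (t : ℝ) :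
    IsOpen {f : C(I, ℝ) | ∃ u v, t * ρ (dist u v) < dist (f u) (f v)} := by
  simp only [Set.ofPred_exists]
  exact isOpen_iUnion fun u => isOpen_iUnion fun v => isOpen_lt continuous_const
    ((continuous_eval_const u).dist (continuous_eval_const v))

theorem IsModulus.isClosed_setOf_exists_increment_ge (hρ : IsModulus ρ) (t δ : ℝ) :
    IsClosed {f : C(I, ℝ) | ∃ u v, δ ≤ dist u v ∧ t * ρ (dist u v) ≤ dist (f u) (f v)} := by
  have hclosed : IsClosed {x : (I × I) × C(I, ℝ) | δ ≤ dist x.1.1 x.1.2 ∧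
      t * ρ (dist x.1.1 x.1.2) ≤ dist (x.2 x.1.1) (x.2 x.1.2)} := by
    have hdist : Continuous fun x : (I × I) × C(I, ℝ) => dist x.1.1 x.1.2 := by fun_prop
    have hgauge : Continuous fun x : (I × I) × C(I, ℝ) => ρ (dist x.1.1 x.1.2) :=
      hρ.continuous_dist (f := fun x : (I × I) × C(I, ℝ) => x.1.1) (by fun_prop) (by fun_prop)
    have hincr : Continuous fun x : (I × I) × C(I, ℝ) => dist (x.2 x.1.1) (x.2 x.1.2) := by
      fun_prop
    exact (isClosed_le continuous_const hdist).inter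
      (isClosed_le (continuous_const.mul hgauge) hincr)
  convert isClosedMap_snd_of_compactSpace _ hclosed using 1
  ext f
  simp only [Set.mem_ofPred_eq, Set.mem_image, Prod.exists, exists_eq_right]

theorem IsModulus.ofReal_lt_holderSeminorm_iff (hρ : IsModulus ρ) (ht : 0 ≤ t) {f : I → ℝ} :
    ENNReal.ofReal t < holderSeminorm ρ f ↔
      ∃ u v, t * ρ (dist u v) < dist (f u) (f v) := by
  rw [← not_le, holderSeminorm_le_ofReal_iff (fun _ => hρ.nonneg) ht]
  simp only [not_forall, not_le]

theorem IsModulus.ofReal_le_holderSeminorm (hρ : IsModulus ρ) (ht : 0 ≤ t) {f : I → ℝ} {u v : I}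
    (huv : 0 < dist u v) (hf : t * ρ (dist u v) ≤ dist (f u) (f v)) :
    ENNReal.ofReal t ≤ holderSeminorm ρ f := by
  have hpos : 0 < ρ |(u : ℝ) - v| := hρ.pos _ ⟨huv, (dist_mem_Icc u v).2⟩
  refine le_trans ?_ (le_iSup₂ (f := fun u v => weightedIncr ρ f u v) u v)
  rw [weightedIncr, ENNReal.le_div_iff_mul_le (Or.inl (ENNReal.ofReal_pos.2 hpos).ne')
    (Or.inl ENNReal.ofReal_ne_top), ← ENNReal.ofReal_mul ht, Real.enorm_eq_ofReal_abs]
  exact ENNReal.ofReal_le_ofReal hf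

theorem IsContinuousProcess.measurable_holderSeminorm (hV : IsContinuousProcess V)
    (hρ : IsModulus ρ) : Measurable fun ω => holderSeminorm ρ fun u => V u ω := by
  borelize C(I, ℝ)
  refine measurable_of_Ioi fun a => ?_
  rcases eq_or_ne a ∞ with rfl | ha
  · simp
  · rw [← ENNReal.ofReal_toReal ha]
    convert hV.measurable_path (isOpen_setOf_exists_increment_gt ρ a.toReal).measurableSet using 1
    ext ω
    exact hρ.ofReal_lt_holderSeminorm_iff ENNReal.toReal_nonneg

theorem TendstoFidi.le_liminf_measure_lt_holderSeminorm (h : TendstoFidi P P' W V)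
    (hW : ∀ n, IsContinuousProcess (W n)) (hV : IsContinuousProcess V)
    (hρ₀ : IsPowerGauge ρ₀ p K) (hmod : UniformLocalModulus P W ρ₀ s) (hρ : IsModulus ρ)
    (ht : 0 ≤ t) :
    P' {ω | ENNReal.ofReal t < holderSeminorm ρ fun u => V u ω} ≤
      liminf (fun n => P n {ω | ENNReal.ofReal t < holderSeminorm ρ fun u => W n u ω}) atTop := by
  borelize C(I, ℝ)
  simp only [hρ.ofReal_lt_holderSeminorm_iff ht]
  exact le_liminf_measure_preimage_of_tendstoInDistribution
    (h.tendstoInDistribution_path hW hV hρ₀ hmod) (isOpen_setOf_exists_increment_gt ρ t)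

theorem TendstoFidi.limsup_measure_lt_holderSeminorm_le (h : TendstoFidi P P' W V)
    (hW : ∀ n, IsContinuousProcess (W n)) (hV : IsContinuousProcess V)
    (hρ₀ : IsPowerGauge ρ₀ p K) (hmod₀ : UniformLocalModulus P W ρ₀ s) (hρ : IsModulus ρ)
    (hmod : UniformLocalModulus P W ρ t) (ht : 0 ≤ t) :
    limsup (fun n => P n {ω | ENNReal.ofReal t < holderSeminorm ρ fun u => W n u ω}) atTop ≤
      P' {ω | ENNReal.ofReal t ≤ holderSeminorm ρ fun u => V u ω} := by
  borelize C(I, ℝ)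
  refine le_of_forall_pos_le_add fun ε hε => ?_
  obtain ⟨r, hr0, hr⟩ := hmod.exists_measure_le hε
  set F : Set C(I, ℝ) := {f | ∃ u v, r ≤ dist u v ∧ t * ρ (dist u v) ≤ dist (f u) (f v)}
  have hsplit (n : ℕ) : P n {ω | ENNReal.ofReal t < holderSeminorm ρ fun u => W n u ω} ≤
      P n ((hW n).path ⁻¹' F) + ε := by
    refine (measure_mono fun ω hω => ?_).trans
      ((measure_union_le _ _).trans (add_le_add_right (hr n) _))
    obtain ⟨u, v, huv⟩ := (hρ.ofReal_lt_holderSeminorm_iff ht).1 hω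
    exact (le_or_gt r (dist u v)).imp (fun hle => ⟨u, v, hle, huv.le⟩)
      fun hlt hloc => (hloc u v hlt.le).not_gt huv
  have hF : limsup (fun n => P n ((hW n).path ⁻¹' F)) atTop ≤ P' (hV.path ⁻¹' F) :=
    limsup_measure_preimage_le_of_tendstoInDistribution
      (h.tendstoInDistribution_path hW hV hρ₀ hmod₀) (hρ.isClosed_setOf_exists_increment_ge t r)
  have hlimit : hV.path ⁻¹' F ⊆ {ω | ENNReal.ofReal t ≤ holderSeminorm ρ fun u => V u ω} :=
    fun ω ⟨u, v, huv, hle⟩ => hρ.ofReal_le_holderSeminorm ht (hr0.trans_le huv) hle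
  calc
    _ ≤ limsup (fun n => P n ((hW n).path ⁻¹' F) + ε) atTop :=
      limsup_le_limsup (.of_forall hsplit)
    _ = limsup (fun n => P n ((hW n).path ⁻¹' F)) atTop + ε :=
      limsup_add_const _ _ _ (by isBoundedDefault) (by isBoundedDefault)
    _ ≤ _ := add_le_add_left (hF.trans (measure_mono hlimit)) ε

theorem measure_le_le_measure_lt_of_continuousAt {X : Ω' → ℝ} (hX : Measurable X)
    (hc : ContinuousAt (fun s => P' {ω | X ω ≤ s}) t) :
    P' {ω | t ≤ X ω} ≤ P' {ω | t < X ω} := by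
  have hcompl (s : ℝ) : P' {ω | s < X ω} = 1 - P' {ω | X ω ≤ s} := by
    rw [← prob_compl_eq_one_sub (measurableSet_le hX measurable_const)]
    simp only [Set.compl_ofPred, not_le]
  have hlim : Tendsto (fun s => P' {ω | s < X ω}) (𝓝[<] t) (𝓝 (P' {ω | t < X ω})) := by
    simp only [hcompl]
    exact ENNReal.Tendsto.sub tendsto_const_nhds (hc.tendsto.mono_left nhdsWithin_le_nhds)
      (Or.inl ENNReal.one_ne_top)
  refine ge_of_tendsto hlim ?_
  filter_upwards [self_mem_nhdsWithin] with s hs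
  exact measure_mono fun ω (hω : t ≤ X ω) => (Set.mem_Iio.1 hs).trans_le hω

theorem TendstoFidi.tendstoBeyond_holderSeminorm (h : TendstoFidi P P' W V)
    (hW : ∀ n, IsContinuousProcess (W n)) (hV : IsContinuousProcess V)
    (hρ₀ : IsPowerGauge ρ₀ p K) (hmod₀ : UniformLocalModulus P W ρ₀ s) (hρ : IsModulus ρ)
    (hC : 0 ≤ C) (hmod : ∀ t, C < t → UniformLocalModulus P W ρ t)
    (hVfin : ∀ᵐ ω ∂P', holderSeminorm ρ (fun u => V u ω) ≠ ∞) :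
    TendstoBeyond C P P' (fun n ω => (holderSeminorm ρ fun u => W n u ω).toReal)
      (fun ω => (holderSeminorm ρ fun u => V u ω).toReal) := by
  intro t hCt hcont
  have ht : 0 < t := hC.trans_lt hCt
  have hlt (n : ℕ) : P n {ω | t < (holderSeminorm ρ fun u => W n u ω).toReal} =
      P n {ω | ENNReal.ofReal t < holderSeminorm ρ fun u => W n u ω} := measure_congr <| by
    filter_upwards [(hmod t hCt).ae_holderSeminorm_ne_top hρ ht.le n] with ω hω
    exact propext (ENNReal.ofReal_lt_iff_lt_toReal ht.le hω).symm
  have hlt' : P' {ω | t < (holderSeminorm ρ fun u => V u ω).toReal} =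
      P' {ω | ENNReal.ofReal t < holderSeminorm ρ fun u => V u ω} := measure_congr <| by
    filter_upwards [hVfin] with ω hω
    exact propext (ENNReal.ofReal_lt_iff_lt_toReal ht.le hω).symm
  have hle' : P' {ω | ENNReal.ofReal t ≤ holderSeminorm ρ fun u => V u ω} =
      P' {ω | t ≤ (holderSeminorm ρ fun u => V u ω).toReal} := measure_congr <| by
    filter_upwards [hVfin] with ω hω
    exact propext (ENNReal.ofReal_le_iff_le_toReal hω)
  simp only [hlt]
  refine tendsto_of_le_liminf_of_limsup_le ?_ ?_ (by isBoundedDefault) (by isBoundedDefault)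
  · exact hlt'.trans_le (h.le_liminf_measure_lt_holderSeminorm hW hV hρ₀ hmod₀ hρ ht.le)
  · calc
      _ ≤ _ := h.limsup_measure_lt_holderSeminorm_le hW hV hρ₀ hmod₀ hρ (hmod t hCt) ht.le
      _ = _ := hle'
      _ ≤ _ := measure_le_le_measure_lt_of_continuousAt
        (hV.measurable_holderSeminorm hρ).ennreal_toReal hcont

end Limits

theorem theorem1
    {Ω : ℕ → Type*} [∀ n, MeasurableSpace (Ω n)]
    (P : ∀ n, Measure (Ω n)) [∀ n, IsProbabilityMeasure (P n)]
    (W : ∀ n, I → Ω n → ℝ) (hW : ∀ n, IsContinuousProcess (W n))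
    (ρ₀ : ℝ → ℝ) (hρ₀_nonneg : ∀ h ∈ Set.Icc (0 : ℝ) 1, 0 ≤ ρ₀ h)
    (hρ₀_mono : MonotoneOn ρ₀ (Set.Icc 0 1)) (hρ₀_zero : ρ₀ 0 = 0)
    (C : ℝ) (hC : 0 < C)
    (hT : ∀ t, C < t → ∃ κ : ℝ, 1 < κ ∧ ∃ K : ℝ, 0 < K ∧ ∀ (n : ℕ) (u v : I),
      P n {ω | ENNReal.ofReal t < weightedIncr ρ₀ (fun x => W n x ω) u v} ≤
        ENNReal.ofReal (K * |(u : ℝ) - v| ^ κ))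
    (hR : ∃ p : ℝ, 0 < p ∧ ∃ K' : ℝ, 0 < K' ∧
      ∀ h ∈ Set.Icc (0 : ℝ) 1, ∀ z ∈ Set.Icc (0 : ℝ) 1, ρ₀ (z * h) ≤ K' * z ^ p * ρ₀ h) :
    -- the local modulus, uniformly in `n`
    (∀ t, C < t → Tendsto
      (fun h => ⨆ n, P n {ω | ENNReal.ofReal t < localHolder ρ₀ h (fun x => W n x ω)})
      (𝓝[>] 0) (𝓝 0)) ∧
    -- stochastic boundedness
    (∀ ρ, IsModulus ρ → MuchLarger ρ ρ₀ → ∀ ε : ℝ≥0∞, 0 < ε → ∃ M : ℝ, ∀ n,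
      P n {ω | ENNReal.ofReal M < holderSeminorm ρ (fun x => W n x ω)} ≤ ε) ∧
    -- weak limits
    (∀ (Ω' : Type*) [MeasurableSpace Ω'] (P' : Measure Ω') [IsProbabilityMeasure P']
      (W' : I → Ω' → ℝ), (∀ u, Measurable (W' u)) → TendstoFidi P P' W W' →
      (∃ V : I → Ω' → ℝ, IsContinuousProcess V ∧ ∀ u, V u =ᵐ[P'] W' u) ∧
      ∀ V : I → Ω' → ℝ, IsContinuousProcess V → (∀ u, V u =ᵐ[P'] W' u) →
        (∀ ρ, IsModulus ρ → MuchLarger ρ ρ₀ → TendstoHolderZero ρ P P' W V) ∧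
        (∀ ρ, IsModulus ρ → Tendsto (fun h => ρ h / ρ₀ h) (𝓝[>] 0) (𝓝 1) →
          (∀ n, ∀ᵐ ω ∂(P n), holderSeminorm ρ (fun x => W n x ω) ≠ ∞) ∧
          (∀ᵐ ω ∂P', holderSeminorm ρ (fun x => V x ω) ≠ ∞) ∧
          TendstoBeyond C P P' (fun n ω => (holderSeminorm ρ (fun x => W n x ω)).toReal)
            (fun ω => (holderSeminorm ρ (fun x => V x ω)).toReal))) := by
  obtain ⟨p, hp, K', hK', hscale⟩ := hR
  have hρ₀ : IsPowerGauge ρ₀ p K' := ⟨hρ₀_mono, hρ₀_zero, hp, hK', hscale⟩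
  have htail : HasIncrTailsBeyond P W ρ₀ C := fun t ht =>
    (hT t ht).imp fun κ => .imp_right <| .imp fun K => .imp_right fun h n =>
      (hasIncrTail_iff_weightedIncr hρ₀_nonneg (hC.trans ht).le).2 (h n)
  have hmod (t : ℝ) (ht : C < t) : UniformLocalModulus P W ρ₀ t :=
    htail.uniformLocalModulus hρ₀ hC.le ht fun n => (hW n).continuous
  obtain ⟨s, hCs⟩ := exists_gt C
  have hs : 0 < s := hC.trans hCs
  refine ⟨fun t ht => (hmod t ht).tendsto_iSup_measure_lt_localHolder hρ₀_nonneg (hC.trans ht).le,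
    fun ρ hρ hm ε hε => ((hmod s hCs).change_gauge hρ.map_zero (hm.eventually_mul_le hρ hs one_pos))
      |>.exists_measure_lt_holderSeminorm_le hρ zero_le_one hε,
    fun Ω' _ P' _ W' hW' hfidi => ⟨?_, fun V hV hVW => ?_⟩⟩
  · obtain ⟨κ, hκ, K, hK, h⟩ := htail s hCs
    obtain ⟨V, hVm, hVc, hVW⟩ := (hfidi.hasIncrTail h).exists_modification hW' hρ₀ hs.le hκ hK.le
    exact ⟨V, ⟨hVm, hVc⟩, hVW⟩
  have hfidiV := hfidi.congr hVW
  have htailV := hfidiV.hasIncrTailsBeyond htail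
  have hmodV := htailV.uniformLocalModulus hρ₀ hC.le hCs fun _ => hV.continuous
  refine ⟨fun ρ hρ hm => hfidiV.tendstoHolderZero hW hV hρ hm hs (hmod s hCs) (hmodV.ae_exists ()),
    fun ρ hρ hratio => ?_⟩
  have hmodρ (t : ℝ) (ht : C < t) : UniformLocalModulus P W ρ t :=
    htail.uniformLocalModulus_of_tendsto_div_one hρ₀ hC.le (fun n => (hW n).continuous) hρ hratio ht
  have hfinV := (htailV.uniformLocalModulus_of_tendsto_div_one hρ₀ hC.le (fun _ => hV.continuous)
    hρ hratio hCs).ae_holderSeminorm_ne_top hρ hs.le ()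
  exact ⟨(hmodρ s hCs).ae_holderSeminorm_ne_top hρ hs.le, hfinV,
    hfidiV.tendstoBeyond_holderSeminorm hW hV hρ₀ (hmod s hCs) hρ hC.le hmodρ hfinV⟩
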